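/- **Setting.** Let $A\in\mathbb R^{n_x\times n_x}$, $B\in\mathbb R^{n_x\times n_u}$, $C\in\mathbb R^{n_y\times n_x}$, let $Q,R,U$ be symmetric positive definite and $W$ symmetric positive semidefinite, of matching sizes, and let $\eta\in(0,1)$, $0\le\lambda_a<\lambda\le 1$, $c_s,c_a\in\mathbb R$. Put $f(X)=AXA^\top+Q$. Let $\bar P\succeq 0$ be a steady-state Kalman error covariance, $\bar P=(I-KC)f(\bar P)$ with $K=f(\bar P)C^\top(Cf(\bar P)C^\top+R)^{-1}$, and let $S_\infty\succeq 0$ solve $$S_\infty=\eta A^\top S_\infty A+W-\eta^2A^\top S_\infty B(\eta B^\top S_\infty B+U)^{-1}B^\top S_\infty A .$$ Suppose that $(1-\lambda_a)|\sigma|^2<\eta$ for every eigenvalue $\sigma\in\mathbb C$ of $A$ (that is, $\lambda_a>1-\eta/\max_i|\sigma_i(A)|^2$). Put $g(\tau)=\operatorname{tr}\big((\eta A^\top S_\infty A+W-S_\infty)f^{\tau}(\bar P)\big)$ for $\tau=0,1,2,\dots$, where $f^\tau$ is the $\tau$-fold iterate. **The game.** The state is the holding time, initially $0$. In each period $k=0,1,2,\dots$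 the controller chooses $\nu_k\in\{0,1\}$ (transmit or not) and the attacker, independently, $a_k\in\{0,1\}$ (attack or not). If $\nu_k=1$, the packet is received with probability $\lambda$ when $a_k=0$ and $\lambda_a$ when $a_k=1$; if $\nu_k=0$ it is not received. The new holding time $\tau_k$ is $0$ on reception and the previous holding time plus $1$ otherwise. A policy $\pi^c$ (resp. $\pi^a$) is any randomized history-dependent rule for choosing $\nu_k$ (resp. $a_k$). The controller minimizes and the attacker maximizes $$J(\pi^c,\pi^a)=\lim_{K\to\infty}\mathbb E\sum_{k=0}^{K-1}\eta^k\big(g(\tau_k)+c_s\nu_k-c_aa_k\big)\in(-\infty,\infty].$$ **Truncation.** For $N\ge1$ the truncated game has the states $0,\dots,N-1$, the new state without reception being $\min(\tau+1,N-1)$. A Nash $Q$-function of it is a function $Q_N(\tau,\nu,a)$, $0\le\tau\le N-1$, such that $$Q_N(\tau,\nu,a)=\mathbb E\big[g(\tau')+c_s\nu-c_aa+\eta\operatorname{val}Q_N(\tau',\cdot,\cdot)\big],$$ where $\tau'$ is the next state in the truncated game when $(\nu,a)$ is played at $\tau$ and $\operatorname{val}$ is the min-max value of a $2\times2$ zero-sum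 matrix game in mixed strategies. A truncated pair $(\pi_N^{c\star},\pi_N^{a\star})$ consists of stationary policies which at each $\tau\le N-2$ play a min-max, respectively a max-min, mixed action of the matrix game $Q_N(\tau,\cdot,\cdot)$, and which for $\tau\ge N-1$ play $\nu=1$ and $a=1$ with probability $1$. **Theorem.** For each $N\ge1$ there is exactly one Nash $Q$-function $Q_N$, and truncated pairs for it exist. There are real numbers $\epsilon_N$, $N\ge 1$, with $\lim_{N\to\infty}\epsilon_N=0$ such that for every $N\ge1$ and every truncated pair $(\pi_N^{c\star},\pi_N^{a\star})$ the cost $J(\pi_N^{c\star},\pi_N^{a\star})$ is finite and the pair is an $\epsilon_N$-Nash equilibrium: $$J(\pi_N^{c\star},\pi_N^{a\star})\le J(\pi^c,\pi_N^{a\star})+\epsilon_N\ \text{ for every policy }\pi^c,\qquad J(\pi_N^{c\star},\pi_N^{a\star})\ge J(\pi_N^{c\star},\pi^a)-\epsilon_N\ \text{ for every policy }\pi^a .$$ -/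

import Mathlib

open Filter Topology Matrix

noncomputable section

namespace HoldingGame

/-! ### The plant: error covariance, Kalman filter, Riccati equation -/

/-- `f(X) = A X Aᵀ + Q`, one step of the error covariance without a reception. -/
def covStep {nx : ℕ} (A Q X : Matrix (Fin nx) (Fin nx) ℝ) : Matrix (Fin nx) (Fin nx) ℝ :=
  A * X * Aᵀ + Q

/-- The Kalman gain `K = f(P) Cᵀ (C f(P) Cᵀ + R)⁻¹`. -/
def kalmanGain {nx ny : ℕ} (A : Matrix (Fin nx) (Fin nx) ℝ) (C : Matrix (Fin ny) (Fin nx) ℝ)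
    (Q : Matrix (Fin nx) (Fin nx) ℝ) (R : Matrix (Fin ny) (Fin ny) ℝ)
    (P : Matrix (Fin nx) (Fin nx) ℝ) : Matrix (Fin nx) (Fin ny) ℝ :=
  covStep A Q P * Cᵀ * (C * covStep A Q P * Cᵀ + R)⁻¹

/-- `P` is a steady-state error covariance of the Kalman filter:
`P = (I - K C) (A P Aᵀ + Q)`, with `P` positive semidefinite. -/
def IsSteadyStateCov {nx ny : ℕ} (A : Matrix (Fin nx) (Fin nx) ℝ)
    (C : Matrix (Fin ny) (Fin nx) ℝ) (Q : Matrix (Fin nx) (Fin nx) ℝ)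
    (R : Matrix (Fin ny) (Fin ny) ℝ) (P : Matrix (Fin nx) (Fin nx) ℝ) : Prop :=
  P.PosSemidef ∧ P = (1 - kalmanGain A C Q R P * C) * covStep A Q P

/-- `S` is a positive semidefinite solution of the discounted control Riccati equation
`S = η Aᵀ S A + W - η² Aᵀ S B (η Bᵀ S B + U)⁻¹ Bᵀ S A`. -/
def IsRiccatiSolution {nx nu : ℕ} (A : Matrix (Fin nx) (Fin nx) ℝ)
    (B : Matrix (Fin nx) (Fin nu) ℝ) (W : Matrix (Fin nx) (Fin nx) ℝ)
    (U : Matrix (Fin nu) (Fin nu) ℝ) (η : ℝ) (S : Matrix (Fin nx) (Fin nx) ℝ) : Prop :=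
  S.PosSemidef ∧
    S = η • (Aᵀ * S * A) + W
      - η ^ 2 • (Aᵀ * S * B * (η • (Bᵀ * S * B) + U)⁻¹ * Bᵀ * S * A)

/-- The estimation part of the running cost at holding time `τ`:
`tr ((η Aᵀ S A + W - S) f^τ(P))`. -/
def estCost {nx : ℕ} (A Q W : Matrix (Fin nx) (Fin nx) ℝ) (η : ℝ)
    (S P : Matrix (Fin nx) (Fin nx) ℝ) (τ : ℕ) : ℝ :=
  ((η • (Aᵀ * S * A) + W - S) * (covStep A Q)^[τ] P).trace

/-! ### The untruncated game on the holding time -/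

/-- The probability of the bit `b` under the Bernoulli law with success probability `p`. -/
def bern (p : ℝ) (b : Bool) : ℝ := if b then p else 1 - p

/-- The probability that the packet is received, given the transmission command `ν` and the
attack command `a`. -/
def recvProb (lam lamA : ℝ) (ν a : Bool) : ℝ :=
  if ν then (if a then lamA else lam) else 0

/-- The immediate cost when the new holding time is `τ` and the actions are `ν`, `a`. -/
def immCost (g : ℕ → ℝ) (cs ca : ℝ) (τ : ℕ) (ν a : Bool) : ℝ :=
  g τ + (if ν then cs else 0) - (if a then ca else 0)

/-- What happens in one period: transmission command, attack command, reception indicator. -/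
abbrev Stage := Bool × Bool × Bool

/-- A finite history of the game, the most recent period first. -/
abbrev History := List Stage

/-- The holding time after a history; it is `0` at the start of the game. -/
def holdTime : History → ℕ
  | [] => 0
  | (ν, _, γ) :: h => if ν && γ then 0 else holdTime h + 1

/-- A randomized history-dependent policy: the probability of choosing action `1`
(transmit, respectively attack) after a given history. -/
abbrev Policy := History → unitInterval

/-- The stationary policy that plays action `1` with probability `σ τ` at holding time `τ`. -/
def stationary (σ : ℕ → unitInterval) : Policy := fun h => σ (holdTime h)

/-- The probability of a history when the two players randomize independently. -/
def pathProb (lam lamA : ℝ) (πc πa : Policy) : History → ℝ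
  | [] => 1
  | (ν, a, γ) :: h =>
      pathProb lam lamA πc πa h * bern (πc h) ν * bern (πa h) a * bern (recvProb lam lamA ν a) γ

/-- The immediate cost of the most recent period of a history. -/
def lastCost (g : ℕ → ℝ) (cs ca : ℝ) : History → ℝ
  | [] => 0
  | (ν, a, γ) :: h => immCost g cs ca (holdTime ((ν, a, γ) :: h)) ν a

/-- The expected immediate cost of period `k` (periods are numbered from `0`). -/
def expCost (g : ℕ → ℝ) (lam lamA cs ca : ℝ) (πc πa : Policy) (k : ℕ) : ℝ :=
  ∑ v : Fin (k + 1) → Stage,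
    pathProb lam lamA πc πa (List.ofFn v) * lastCost g cs ca (List.ofFn v)

/-- The infinite-horizon discounted cost `J(πc, πa)`, the limit of the expected discounted costs
of the first `K` periods. For nonnegative `g` and `η ∈ (0, 1)` this limit always exists
in `(-∞, ∞]`; the value `∞` does occur, for instance if the controller never transmits. -/
def cost (g : ℕ → ℝ) (lam lamA cs ca η : ℝ) (πc πa : Policy) : EReal :=
  limsup (fun K : ℕ =>
    ((∑ k ∈ Finset.range K, η ^ k * expCost g lam lamA cs ca πc πa k : ℝ) : EReal)) atTop

/-! ### The truncated game, its Nash Q-function and the truncated policies -/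

/-- The transition of the truncated holding time, with the `N` states `0, …, N - 1`. -/
def truncNext {N : ℕ} (τ : Fin N) (ν γ : Bool) : Fin N :=
  if ν && γ then ⟨0, τ.pos⟩
  else ⟨min (τ.val + 1) (N - 1), lt_of_le_of_lt (min_le_right _ _) (Nat.sub_one_lt_of_lt τ.pos)⟩

/-- The expected payoff of the matrix game `M` when the controller plays `1` with
probability `p` and the attacker plays `1` with probability `q`. -/
def payoff (M : Bool → Bool → ℝ) (p q : ℝ) : ℝ :=
  ∑ ν : Bool, ∑ a : Bool, M ν a * bern p ν * bern q a

/-- The (min-max) value in mixed strategies of the zero-sum matrix game `M`. -/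
def matrixValue (M : Bool → Bool → ℝ) : ℝ :=
  ⨅ p : unitInterval, ⨆ q : unitInterval, payoff M p q

/-- `Qf` is the Nash Q-function of the discounted truncated game: `Qf τ ν a` is the expected
cost when `(ν, a)` is played at `τ` and the continuation is valued by the equilibrium value. -/
def IsNashQ (g : ℕ → ℝ) (lam lamA cs ca η : ℝ) {N : ℕ} (Qf : Fin N → Bool → Bool → ℝ) : Prop :=
  ∀ τ ν a, Qf τ ν a = ∑ γ : Bool, bern (recvProb lam lamA ν a) γ *
    (immCost g cs ca (truncNext τ ν γ) ν a + η * matrixValue (Qf (truncNext τ ν γ)))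

/-- `(σc, σa)` is a pair of truncated policies for `Qf`: a min-max, respectively max-min, mixed
action of the matrix game `Qf τ` for `τ ≤ N - 2`, and action `1` with certainty
for `τ ≥ N - 1`. -/
def IsTruncatedPair {N : ℕ} (Qf : Fin N → Bool → Bool → ℝ) (σc σa : ℕ → unitInterval) : Prop :=
  (∀ τ : Fin N, τ.val + 1 < N →
    (∀ p : unitInterval,
      (⨆ q : unitInterval, payoff (Qf τ) (σc τ) q) ≤ ⨆ q : unitInterval, payoff (Qf τ) p q) ∧
    (∀ q : unitInterval,
      (⨅ p : unitInterval, payoff (Qf τ) p q) ≤ ⨅ p : unitInterval, payoff (Qf τ) p (σa τ))) ∧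
  (∀ τ : ℕ, N ≤ τ + 1 → σc τ = 1 ∧ σa τ = 1)

end HoldingGame

end

/-! The Riccati equation writes `η Aᵀ S A + W - S` as a congruence of a positive semidefinite
inverse, and the filter equation does the same for `f(P) - P`. Hence `g` is nonnegative and
increasing. The spectral condition gives `g τ ≤ C r^τ` with `η (1 - lamA) r < 1`, and `g` is bounded
if `lamA = 0`.

Capping the state at `N - 1` amounts to keeping the original game and replacing `g` by the stopped
cost `g (min t (N - 1))` (`IsNashQ.eq_bellman`). So the truncated equilibrium value `V` extends to a
bounded solution of a Shapley equation on all holding times, and it inherits monotonicity from `g`.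
The Nash Q-function is the fixed point of an `η`-contraction, because the matrix value is
nonexpansive.

Near-optimality is a verification argument. If `V + w` is a supersolution of the true Bellman
inequality under the controller's truncated policy, that policy costs at most `V 0 + w 0` against
every attacker (`cost_le_of_supersolution`); subsolutions serve the attacker. Two guarantees `V 0 ±
e` make the pair a `2 e`-equilibrium. It remains to find a weight `w` with `w 0 → 0`.

For bounded `g`, discounting suffices, since level `N - 1` is not reached before `N - 1` periods: `w
0` is of order `η^(N-1)` (`exists_truncErrorLE_of_bounded`). For unbounded `g` one has `lamA > 0`.
Beyond some `T₀` independent of `N`, losing the packet is so costly that transmitting strictly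
dominates and attacking is a best reply to it. Each further step up then has discounted probability
at most `η (1 - lamA)`, which beats the growth rate `r`; `exists_weight` builds the corresponding
weight (`exists_truncErrorLE_of_gap`). The finitely many small `N` need only some finite error. -/

noncomputable section

namespace HoldingGame

/-! ### Matrix games with two actions for each player -/

lemma payoff_eq (M : Bool → Bool → ℝ) (p q : ℝ) :
    payoff M p q = p * (q * M true true + (1 - q) * M true false)
      + (1 - p) * (q * M false true + (1 - q) * M false false) := by
  simp [payoff, bern]; ring

lemma payoff_zero (p q : ℝ) : payoff (fun _ _ => 0) p q = 0 := by
  simp [payoff]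

lemma payoff_eq_right (M : Bool → Bool → ℝ) (p q : ℝ) :
    payoff M p q = (1 - q) * payoff M p 0 + q * payoff M p 1 := by
  simp only [payoff_eq]; ring

lemma payoff_eq_left (M : Bool → Bool → ℝ) (p q : ℝ) :
    payoff M p q = (1 - p) * payoff M 0 q + p * payoff M 1 q := by
  simp only [payoff_eq]; ring

lemma convex_comb_le {t a b c : ℝ} (ht0 : 0 ≤ t) (ht1 : t ≤ 1) (ha : a ≤ c) (hb : b ≤ c) :
    (1 - t) * a + t * b ≤ c := by
  nlinarith

lemma le_convex_comb {t a b c : ℝ} (ht0 : 0 ≤ t) (ht1 : t ≤ 1) (ha : c ≤ a) (hb : c ≤ b) :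
    c ≤ (1 - t) * a + t * b := by
  nlinarith

lemma payoff_le_max (M : Bool → Bool → ℝ) (p : ℝ) (q : unitInterval) :
    payoff M p q ≤ max (payoff M p 0) (payoff M p 1) := by
  rw [payoff_eq_right]
  exact convex_comb_le q.2.1 q.2.2 (le_max_left _ _) (le_max_right _ _)

lemma min_le_payoff (M : Bool → Bool → ℝ) (p : unitInterval) (q : ℝ) :
    min (payoff M 0 q) (payoff M 1 q) ≤ payoff M p q := by
  rw [payoff_eq_left M p]
  exact le_convex_comb p.2.1 p.2.2 (min_le_left _ _) (min_le_right _ _)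

lemma iSup_payoff (M : Bool → Bool → ℝ) (p : ℝ) :
    ⨆ q : unitInterval, payoff M p q = max (payoff M p 0) (payoff M p 1) := by
  have hb : BddAbove (Set.range fun q : unitInterval => payoff M p q) :=
    ⟨_, Set.forall_mem_range.2 (payoff_le_max M p)⟩
  refine le_antisymm (ciSup_le (payoff_le_max M p)) (max_le ?_ ?_)
  · simpa using le_ciSup hb 0
  · simpa using le_ciSup hb 1

lemma iInf_payoff (M : Bool → Bool → ℝ) (q : ℝ) :
    ⨅ p : unitInterval, payoff M p q = min (payoff M 0 q) (payoff M 1 q) := by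
  have hb : BddBelow (Set.range fun p : unitInterval => payoff M p q) :=
    ⟨_, Set.forall_mem_range.2 (fun p => min_le_payoff M p q)⟩
  refine le_antisymm (le_min ?_ ?_) (le_ciInf (fun p => min_le_payoff M p q))
  · simpa using ciInf_le hb 0
  · simpa using ciInf_le hb 1

lemma exists_isMinOn_iSup_payoff (M : Bool → Bool → ℝ) :
    ∃ p₀ : unitInterval, ∀ p : unitInterval,
      ⨆ q : unitInterval, payoff M p₀ q ≤ ⨆ q : unitInterval, payoff M p q := by
  have hc : Continuous fun p : unitInterval => ⨆ q : unitInterval, payoff M p q := by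
    simp only [iSup_payoff]
    simp only [payoff_eq]
    fun_prop
  obtain ⟨p₀, -, h⟩ := isCompact_univ.exists_isMinOn Set.univ_nonempty hc.continuousOn
  exact ⟨p₀, fun p => h (Set.mem_univ p)⟩

lemma exists_isMaxOn_iInf_payoff (M : Bool → Bool → ℝ) :
    ∃ q₀ : unitInterval, ∀ q : unitInterval,
      ⨅ p : unitInterval, payoff M p q ≤ ⨅ p : unitInterval, payoff M p q₀ := by
  have hc : Continuous fun q : unitInterval => ⨅ p : unitInterval, payoff M p q := by
    simp only [iInf_payoff]
    simp only [payoff_eq]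
    fun_prop
  obtain ⟨q₀, -, h⟩ := isCompact_univ.exists_isMaxOn Set.univ_nonempty hc.continuousOn
  exact ⟨q₀, fun q => h (Set.mem_univ q)⟩

lemma bddBelow_range_iSup_payoff (M : Bool → Bool → ℝ) :
    BddBelow (Set.range fun p : unitInterval => ⨆ q : unitInterval, payoff M p q) := by
  obtain ⟨p₀, h⟩ := exists_isMinOn_iSup_payoff M
  exact ⟨_, Set.forall_mem_range.2 h⟩

lemma matrixValue_le (M : Bool → Bool → ℝ) (p : unitInterval) :
    matrixValue M ≤ max (payoff M p 0) (payoff M p 1) := by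
  rw [← iSup_payoff]
  exact ciInf_le (bddBelow_range_iSup_payoff M) p

lemma le_matrixValue {M : Bool → Bool → ℝ} {c : ℝ}
    (h : ∀ p : unitInterval, c ≤ max (payoff M p 0) (payoff M p 1)) : c ≤ matrixValue M :=
  le_ciInf fun p => by rw [iSup_payoff]; exact h p

lemma payoff_le_matrixValue_of_minmax {M : Bool → Bool → ℝ} {p₀ : unitInterval}
    (h : ∀ p : unitInterval,
      ⨆ q : unitInterval, payoff M p₀ q ≤ ⨆ q : unitInterval, payoff M p q) (q : unitInterval) :
    payoff M p₀ q ≤ matrixValue M := by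
  refine (payoff_le_max M p₀ q).trans ?_
  rw [← iSup_payoff]
  exact le_ciInf h

/-- The minimax theorem for two actions: the second player can guarantee any amount which no
mixed action of the first player undercuts. -/
lemma exists_mixed_guarantee {a b c d v : ℝ}
    (h : ∀ p : unitInterval,
      v ≤ max ((1 - p) * a + p * c) ((1 - p) * b + p * d)) :
    ∃ q : unitInterval, v ≤ (1 - q) * a + q * b ∧ v ≤ (1 - q) * c + q * d := by
  have h0 : v ≤ a ∨ v ≤ b := by simpa using h 0
  have h1 : v ≤ c ∨ v ≤ d := by simpa using h 1
  by_cases hac : v ≤ a ∧ v ≤ c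
  · exact ⟨0, by simpa using hac⟩
  by_cases hbd : v ≤ b ∧ v ≤ d
  · exact ⟨1, by simpa using hbd⟩
  -- No pure column works, so the entries on one diagonal are at least `v` and the others lie below
  -- it. Testing the hypothesis at the `p` that equalizes the two columns gives this determinant
  -- inequality.
  have key : ∀ x y z w : ℝ, v ≤ x → y < v → z < v → v ≤ w →
      (∀ p : unitInterval, v ≤ max ((1 - p) * x + p * y) ((1 - p) * z + p * w)) →
      (x - v) * (w - v) - (y - v) * (z - v) ≥ 0 := by
    intro x y z w hx hy hz hw hp
    have hs : 0 < (x - z) + (w - y) := by linarith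
    let p : unitInterval := ⟨(x - z) / ((x - z) + (w - y)),
      div_nonneg (by linarith) hs.le, (div_le_one hs).2 (by linarith)⟩
    have hpv : (p : ℝ) * ((x - z) + (w - y)) = x - z := div_mul_cancel₀ _ hs.ne'
    have hm := hp p
    have heq : (1 - (p : ℝ)) * x + p * y = (1 - p) * z + p * w := by linarith
    rw [heq, max_self] at hm
    have hval : ((1 - (p : ℝ)) * z + p * w - v) * ((x - z) + (w - y))
        = (x - v) * (w - v) - (y - v) * (z - v) := by
      linear_combination (w - z) * hpv
    rw [← hval]
    exact mul_nonneg (by linarith) hs.le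
  rcases le_or_gt v a with ha | ha
  · have hc : c < v := by
      by_contra hc
      exact hac ⟨ha, not_lt.1 hc⟩
    have hd : v ≤ d := h1.resolve_left (not_le.2 hc)
    have hb : b < v := by
      by_contra hb
      exact hbd ⟨not_lt.1 hb, hd⟩
    have hk := key a c b d ha hc hb hd h
    have hs : 0 < a - b := by linarith
    -- This `q` makes the first row exactly `v`; the determinant inequality then says that the
    -- second row is at least `v`.
    let q : unitInterval := ⟨(a - v) / (a - b), div_nonneg (by linarith) hs.le,
      (div_le_one hs).2 (by linarith)⟩
    have hq : (q : ℝ) * (a - b) = a - v := div_mul_cancel₀ _ hs.ne'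
    refine ⟨q, by linarith, ?_⟩
    refine le_of_mul_le_mul_right ?_ hs
    linear_combination hk + (c - d) * hq
  · have hb : v ≤ b := h0.resolve_left (not_le.2 ha)
    have hd : d < v := by
      by_contra hd
      exact hbd ⟨hb, not_lt.1 hd⟩
    have hc : v ≤ c := h1.resolve_right (not_le.2 hd)
    have hk := key b d a c hb hd ha hc (fun p => by rw [max_comm]; exact h p)
    have hs : 0 < b - a := by linarith
    let q : unitInterval := ⟨(v - a) / (b - a), div_nonneg (by linarith) hs.le,
      (div_le_one hs).2 (by linarith)⟩
    have hq : (q : ℝ) * (b - a) = v - a := div_mul_cancel₀ _ hs.ne'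
    refine ⟨q, by linarith, ?_⟩
    refine le_of_mul_le_mul_right ?_ hs
    linear_combination hk + (c - d) * hq

/-- The value is defined as a min-max, so the guarantee of a max-min action needs the minimax
theorem. -/
lemma matrixValue_le_payoff_of_maxmin {M : Bool → Bool → ℝ} {q₀ : unitInterval}
    (h : ∀ q : unitInterval,
      ⨅ p : unitInterval, payoff M p q ≤ ⨅ p : unitInterval, payoff M p q₀) (p : unitInterval) :
    matrixValue M ≤ payoff M p q₀ := by
  obtain ⟨q, h0, h1⟩ := exists_mixed_guarantee
    (a := payoff M 0 0) (b := payoff M 0 1) (c := payoff M 1 0) (d := payoff M 1 1)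
    (v := matrixValue M) (fun p => by
      rw [← payoff_eq_left, ← payoff_eq_left]; exact matrixValue_le M p)
  rw [← payoff_eq_right] at h0 h1
  refine le_trans ?_ (min_le_payoff M p q₀)
  rw [← iInf_payoff]
  refine le_trans ?_ (h q)
  rw [iInf_payoff]
  exact le_min h0 h1

lemma payoff_le_payoff_add {M M' : Bool → Bool → ℝ} {c p q : ℝ} (hp0 : 0 ≤ p) (hp1 : p ≤ 1)
    (hq0 : 0 ≤ q) (hq1 : q ≤ 1) (h : ∀ ν a, M ν a ≤ M' ν a + c) :
    payoff M p q ≤ payoff M' p q + c := by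
  have e : payoff M' p q + c = payoff (fun ν a => M' ν a + c) p q := by
    simp only [payoff_eq]; ring
  rw [e, payoff_eq, payoff_eq]
  have hp2 : 0 ≤ 1 - p := by linarith
  have hq2 : 0 ≤ 1 - q := by linarith
  gcongr <;> exact h _ _

/-- The value is monotone and commutes with adding constants. This gives the nonexpansiveness behind
the contraction and all value comparisons below. -/
lemma matrixValue_le_add {M M' : Bool → Bool → ℝ} {c : ℝ} (h : ∀ ν a, M ν a ≤ M' ν a + c) :
    matrixValue M ≤ matrixValue M' + c := by
  rw [← sub_le_iff_le_add]
  refine le_matrixValue fun p => ?_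
  rw [sub_le_iff_le_add]
  refine (matrixValue_le M p).trans ?_
  rw [← max_add_add_right]
  exact max_le_max (payoff_le_payoff_add p.2.1 p.2.2 le_rfl zero_le_one h)
    (payoff_le_payoff_add p.2.1 p.2.2 zero_le_one le_rfl h)

lemma matrixValue_zero : matrixValue (fun _ _ => 0) = 0 := by
  simp [matrixValue, payoff_zero]

lemma abs_matrixValue_sub_le {M M' : Bool → Bool → ℝ} {c : ℝ}
    (h : ∀ ν a, |M ν a - M' ν a| ≤ c) : |matrixValue M - matrixValue M'| ≤ c := by
  have h1 := matrixValue_le_add (M := M) (M' := M') (c := c)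
    (fun ν a => by have := (abs_le.1 (h ν a)).2; linarith)
  have h2 := matrixValue_le_add (M := M') (M' := M) (c := c)
    (fun ν a => by have := (abs_le.1 (h ν a)).1; linarith)
  exact abs_le.2 ⟨by linarith, by linarith⟩

lemma abs_matrixValue_le {M : Bool → Bool → ℝ} {c : ℝ} (h : ∀ ν a, |M ν a| ≤ c) :
    |matrixValue M| ≤ c := by
  have := abs_matrixValue_sub_le (M := M) (M' := fun _ _ => 0) (c := c) (by simpa using h)
  rwa [matrixValue_zero, sub_zero] at this

/-- A mixed min-max action plays a strictly dominant action with certainty. -/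
lemma minmax_eq_one_of_dominant {M : Bool → Bool → ℝ} {p₀ : unitInterval}
    (h : ∀ p : unitInterval,
      ⨆ q : unitInterval, payoff M p₀ q ≤ ⨆ q : unitInterval, payoff M p q)
    (hd : ∀ a, M true a < M false a) : p₀ = 1 := by
  have h1 := h 1
  simp only [iSup_payoff] at h1
  simp only [payoff_eq, Set.Icc.coe_one] at h1
  by_contra hne
  have hlt : (0 : ℝ) < 1 - p₀ := by
    have : (p₀ : ℝ) ≠ 1 := fun e => hne (Subtype.ext e)
    have := lt_of_le_of_ne p₀.2.2 this
    linarith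
  have a1 := mul_lt_mul_of_pos_left (hd true) hlt
  have a2 := mul_lt_mul_of_pos_left (hd false) hlt
  refine absurd h1 (not_le.2 (max_lt (lt_max_of_lt_left ?_) (lt_max_of_lt_right ?_))) <;> linarith

lemma matrixValue_le_of_dominant {M : Bool → Bool → ℝ} (h : M true false ≤ M true true) :
    matrixValue M ≤ M true true := by
  have := matrixValue_le M 1
  simpa [payoff_eq, h] using this

lemma le_matrixValue_row {M : Bool → Bool → ℝ} (hd : ∀ a, M true a < M false a) (a : Bool) :
    M true a ≤ matrixValue M := by
  refine le_matrixValue fun p => ?_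
  have hp : (0 : ℝ) ≤ 1 - p := by have := p.2.2; linarith
  have := mul_le_mul_of_nonneg_left (hd a).le hp
  cases a
  · refine le_max_of_le_left ?_
    rw [payoff_eq]; linarith
  · refine le_max_of_le_right ?_
    rw [payoff_eq]; linarith

/-! ### The Bellman operator and verification of cost bounds -/

/-- The matrix game played at holding time `τ` when the continuation is valued by `H`. -/
def bellman (g : ℕ → ℝ) (lam lamA cs ca η : ℝ) (H : ℕ → ℝ) (τ : ℕ) (ν a : Bool) : ℝ :=
  recvProb lam lamA ν a * (g 0 + η * H 0)
    + (1 - recvProb lam lamA ν a) * (g (τ + 1) + η * H (τ + 1))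
    + (if ν then cs else 0) - (if a then ca else 0)

lemma recvProb_nonneg {lam lamA : ℝ} (h0 : 0 ≤ lamA) (h1 : lamA ≤ lam) (ν a : Bool) :
    0 ≤ recvProb lam lamA ν a := by
  cases ν <;> cases a <;> simp [recvProb] <;> linarith

lemma recvProb_le_one {lam lamA : ℝ} (h1 : lamA ≤ lam) (h2 : lam ≤ 1) (ν a : Bool) :
    recvProb lam lamA ν a ≤ 1 := by
  cases ν <;> cases a <;> simp [recvProb] <;> linarith

lemma bern_nonneg {p : ℝ} (h0 : 0 ≤ p) (h1 : p ≤ 1) (b : Bool) : 0 ≤ bern p b := by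
  cases b <;> simp [bern] <;> linarith

lemma sum_bern (p : ℝ) : ∑ b, bern p b = 1 := by
  simp [bern]

/-- The expectation of a function of the history of the first `k` periods. -/
def histExp (lam lamA : ℝ) (πc πa : Policy) (k : ℕ) (F : History → ℝ) : ℝ :=
  ∑ v : Fin k → Stage, pathProb lam lamA πc πa (List.ofFn v) * F (List.ofFn v)

/-- The conditional probability of the outcome of the next period, given the history. -/
def stageProb (lam lamA : ℝ) (πc πa : Policy) (h : History) (x : Stage) : ℝ :=
  bern (πc h) x.1 * bern (πa h) x.2.1 * bern (recvProb lam lamA x.1 x.2.1) x.2.2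

/-! ### Expectations over histories and the one-step identity -/

section Histories

variable {lam lamA : ℝ} {πc πa : Policy}

lemma histExp_zero (F : History → ℝ) : histExp lam lamA πc πa 0 F = F [] := by
  simp [histExp, pathProb]

lemma histExp_succ (k : ℕ) (F : History → ℝ) :
    histExp lam lamA πc πa (k + 1) F = histExp lam lamA πc πa k
      (fun h => ∑ x : Stage, stageProb lam lamA πc πa h x * F (x :: h)) := by
  unfold histExp
  -- The head of the list is the most recent period, so splitting off coordinate `0` conditions on
  -- the first `k` periods.
  rw [← (Fin.consEquiv (fun _ : Fin (k + 1) => Stage)).sum_comp, Fintype.sum_prod_type,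
    Finset.sum_comm]
  refine Finset.sum_congr rfl fun v _ => ?_
  rw [Finset.mul_sum]
  refine Finset.sum_congr rfl fun x _ => ?_
  obtain ⟨ν, a, γ⟩ := x
  simp [Fin.consEquiv, List.ofFn_succ, pathProb, stageProb]
  ring

lemma pathProb_nonneg (h0 : 0 ≤ lamA) (h1 : lamA ≤ lam) (h2 : lam ≤ 1) (h : History) :
    0 ≤ pathProb lam lamA πc πa h := by
  induction h with
  | nil => exact zero_le_one
  | cons x h ih =>
    obtain ⟨ν, a, γ⟩ := x
    exact mul_nonneg (mul_nonneg (mul_nonneg ih (bern_nonneg (πc h).2.1 (πc h).2.2 ν))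
      (bern_nonneg (πa h).2.1 (πa h).2.2 a))
      (bern_nonneg (recvProb_nonneg h0 h1 ν a) (recvProb_le_one h1 h2 ν a) γ)

lemma histExp_mono (h0 : 0 ≤ lamA) (h1 : lamA ≤ lam) (h2 : lam ≤ 1) (k : ℕ) {F G : History → ℝ}
    (h : ∀ x, F x ≤ G x) : histExp lam lamA πc πa k F ≤ histExp lam lamA πc πa k G :=
  Finset.sum_le_sum fun _ _ => mul_le_mul_of_nonneg_left (h _) (pathProb_nonneg h0 h1 h2 _)

lemma histExp_add (k : ℕ) (F G : History → ℝ) :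
    histExp lam lamA πc πa k (fun h => F h + G h)
      = histExp lam lamA πc πa k F + histExp lam lamA πc πa k G := by
  simp [histExp, mul_add, Finset.sum_add_distrib]

lemma histExp_const_mul (k : ℕ) (c : ℝ) (F : History → ℝ) :
    histExp lam lamA πc πa k (fun h => c * F h) = c * histExp lam lamA πc πa k F := by
  simp only [histExp, Finset.mul_sum]
  exact Finset.sum_congr rfl fun _ _ => by ring

lemma sum_stageProb (h : History) : ∑ x : Stage, stageProb lam lamA πc πa h x = 1 := by
  simp only [stageProb, Fintype.sum_prod_type, Fintype.sum_bool, bern]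
  simp only [if_true, Bool.false_eq_true, if_false]
  ring

lemma histExp_const (k : ℕ) (c : ℝ) : histExp lam lamA πc πa k (fun _ => c) = c := by
  induction k with
  | zero => rw [histExp_zero]
  | succ k ih =>
    rw [histExp_succ]
    simp only [← Finset.sum_mul, sum_stageProb, one_mul, ih]

lemma expCost_eq (g : ℕ → ℝ) (cs ca : ℝ) (k : ℕ) :
    expCost g lam lamA cs ca πc πa k = histExp lam lamA πc πa (k + 1) (lastCost g cs ca) := rfl

lemma sum_stageProb_mul (g : ℕ → ℝ) (cs ca η : ℝ) (H : ℕ → ℝ) (h : History) :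
    ∑ x : Stage, stageProb lam lamA πc πa h x *
        (lastCost g cs ca (x :: h) + η * H (holdTime (x :: h)))
      = payoff (bellman g lam lamA cs ca η H (holdTime h)) (πc h) (πa h) := by
  simp only [stageProb, Fintype.sum_prod_type, Fintype.sum_bool, bern, payoff_eq, bellman,
    lastCost, immCost, holdTime, recvProb]
  simp
  ring

/-- The dynamic programming step: multiplied by `η ^ k` and summed over `k`, it telescopes against
any Bellman inequality for `H`. -/
lemma expCost_add_histExp (g : ℕ → ℝ) (cs ca η : ℝ) (H : ℕ → ℝ) (k : ℕ) :
    expCost g lam lamA cs ca πc πa k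
        + η * histExp lam lamA πc πa (k + 1) (fun h => H (holdTime h))
      = histExp lam lamA πc πa k
        (fun h => payoff (bellman g lam lamA cs ca η H (holdTime h)) (πc h) (πa h)) := by
  rw [expCost_eq, ← histExp_const_mul, ← histExp_add, histExp_succ]
  simp only [sum_stageProb_mul]

end Histories

section Verification

variable {g : ℕ → ℝ} {lam lamA cs ca η : ℝ}

lemma partialCost_add_le (hlamA : 0 ≤ lamA) (hlt : lamA ≤ lam) (hlam : lam ≤ 1) (hη0 : 0 ≤ η)
    {πc πa : Policy} {H : ℕ → ℝ}
    (hH : ∀ h, payoff (bellman g lam lamA cs ca η H (holdTime h)) (πc h) (πa h)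
      ≤ H (holdTime h)) (K : ℕ) :
    ∑ k ∈ Finset.range K, η ^ k * expCost g lam lamA cs ca πc πa k
      + η ^ K * histExp lam lamA πc πa K (fun h => H (holdTime h)) ≤ H 0 := by
  induction K with
  | zero => simp [histExp_zero, holdTime]
  | succ K ih =>
    have h1 := expCost_add_histExp (πc := πc) (πa := πa) (lam := lam) (lamA := lamA) g cs ca η H K
    have h2 := histExp_mono (πc := πc) (πa := πa) hlamA hlt hlam K hH
    have h3 := mul_le_mul_of_nonneg_left (h1.le.trans h2) (pow_nonneg hη0 K)
    rw [Finset.sum_range_succ, pow_succ]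
    linarith

lemma le_partialCost_add (hlamA : 0 ≤ lamA) (hlt : lamA ≤ lam) (hlam : lam ≤ 1) (hη0 : 0 ≤ η)
    {πc πa : Policy} {L : ℕ → ℝ}
    (hL : ∀ h, L (holdTime h)
      ≤ payoff (bellman g lam lamA cs ca η L (holdTime h)) (πc h) (πa h)) (K : ℕ) :
    L 0 ≤ ∑ k ∈ Finset.range K, η ^ k * expCost g lam lamA cs ca πc πa k
      + η ^ K * histExp lam lamA πc πa K (fun h => L (holdTime h)) := by
  induction K with
  | zero => simp [histExp_zero, holdTime]
  | succ K ih =>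
    have h1 := expCost_add_histExp (πc := πc) (πa := πa) (lam := lam) (lamA := lamA) g cs ca η L K
    have h2 := histExp_mono (πc := πc) (πa := πa) hlamA hlt hlam K hL
    have h3 := mul_le_mul_of_nonneg_left (h2.trans h1.ge) (pow_nonneg hη0 K)
    rw [Finset.sum_range_succ, pow_succ]
    linarith

/-- A supersolution of the Bellman inequality which is bounded below bounds the cost. -/
lemma cost_le_of_supersolution (hlamA : 0 ≤ lamA) (hlt : lamA ≤ lam) (hlam : lam ≤ 1)
    (hη0 : 0 ≤ η) (hη1 : η < 1) {πc πa : Policy} {H : ℕ → ℝ} {c : ℝ} (hc : ∀ τ, c ≤ H τ)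
    (hH : ∀ h, payoff (bellman g lam lamA cs ca η H (holdTime h)) (πc h) (πa h)
      ≤ H (holdTime h)) :
    cost g lam lamA cs ca η πc πa ≤ (H 0 : EReal) := by
  have hlim : Tendsto (fun K : ℕ => ((H 0 - η ^ K * c : ℝ) : EReal)) atTop (𝓝 (H 0 : EReal)) := by
    refine (continuous_coe_real_ereal.tendsto _).comp ?_
    simpa using ((tendsto_pow_atTop_nhds_zero_of_lt_one hη0 hη1).mul_const c).const_sub (H 0)
  rw [← hlim.limsup_eq]
  refine limsup_le_limsup (Eventually.of_forall fun K => ?_)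
  refine EReal.coe_le_coe_iff.2 ?_
  -- The lower bound on `H` is needed only here: the remainder `η ^ K * E[H]` is at least `η ^ K *
  -- c`, which vanishes in the limit.
  have h1 := partialCost_add_le hlamA hlt hlam hη0 hH K
  have h2 := histExp_mono (πc := πc) (πa := πa) hlamA hlt hlam K (fun h => hc (holdTime h))
  rw [histExp_const] at h2
  have h3 := mul_le_mul_of_nonneg_left h2 (pow_nonneg hη0 K)
  linarith

/-- A subsolution of the Bellman inequality which is bounded above bounds the cost from below. -/
lemma le_cost_of_subsolution (hlamA : 0 ≤ lamA) (hlt : lamA ≤ lam) (hlam : lam ≤ 1)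
    (hη0 : 0 ≤ η) (hη1 : η < 1) {πc πa : Policy} {L : ℕ → ℝ} {c : ℝ} (hc : ∀ τ, L τ ≤ c)
    (hL : ∀ h, L (holdTime h)
      ≤ payoff (bellman g lam lamA cs ca η L (holdTime h)) (πc h) (πa h)) :
    (L 0 : EReal) ≤ cost g lam lamA cs ca η πc πa := by
  have hlim : Tendsto (fun K : ℕ => ((L 0 - η ^ K * c : ℝ) : EReal)) atTop (𝓝 (L 0 : EReal)) := by
    refine (continuous_coe_real_ereal.tendsto _).comp ?_
    simpa using ((tendsto_pow_atTop_nhds_zero_of_lt_one hη0 hη1).mul_const c).const_sub (L 0)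
  rw [← hlim.limsup_eq]
  refine limsup_le_limsup (Eventually.of_forall fun K => ?_)
  refine EReal.coe_le_coe_iff.2 ?_
  have h1 := le_partialCost_add hlamA hlt hlam hη0 hL K
  have h2 := histExp_mono (πc := πc) (πa := πa) hlamA hlt hlam K (fun h => hc (holdTime h))
  rw [histExp_const] at h2
  have h3 := mul_le_mul_of_nonneg_left h2 (pow_nonneg hη0 K)
  linarith

end Verification

/-! ### The truncated game -/

section Bellman

variable {g g' : ℕ → ℝ} {lam lamA cs ca η : ℝ} {H H' : ℕ → ℝ} {τ τ' : ℕ} {ν a : Bool}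

lemma bellman_le_add (hlamA : 0 ≤ lamA) (hlt : lamA ≤ lam) (hlam : lam ≤ 1) {c : ℝ}
    (h0 : g 0 + η * H 0 ≤ g' 0 + η * H' 0 + c)
    (h1 : g (τ + 1) + η * H (τ + 1) ≤ g' (τ' + 1) + η * H' (τ' + 1) + c) :
    bellman g lam lamA cs ca η H τ ν a ≤ bellman g' lam lamA cs ca η H' τ' ν a + c := by
  have hp0 := recvProb_nonneg hlamA hlt ν a
  have hp1 : 0 ≤ 1 - recvProb lam lamA ν a := by
    have := recvProb_le_one hlt hlam ν a
    linarith
  unfold bellman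
  linarith [mul_le_mul_of_nonneg_left h0 hp0, mul_le_mul_of_nonneg_left h1 hp1]

lemma abs_bellman_le (hlamA : 0 ≤ lamA) (hlt : lamA ≤ lam) (hlam : lam ≤ 1) {c : ℝ}
    (h0 : |g 0 + η * H 0| ≤ c) (h1 : |g (τ + 1) + η * H (τ + 1)| ≤ c) :
    |bellman g lam lamA cs ca η H τ ν a| ≤ c + |cs| + |ca| := by
  have hp0 := recvProb_nonneg hlamA hlt ν a
  have hp1 := recvProb_le_one hlt hlam ν a
  have hcs : |if ν then cs else 0| ≤ |cs| := by split_ifs <;> simp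
  have hca : |if a then ca else 0| ≤ |ca| := by split_ifs <;> simp
  rw [abs_le] at h0 h1 hcs hca ⊢
  have u := convex_comb_le hp0 hp1 h1.2 h0.2
  have l := le_convex_comb hp0 hp1 h1.1 h0.1
  unfold bellman
  constructor <;> linarith

end Bellman

/-- A value function: a bounded solution of the Shapley equation. -/
structure IsValueFn (g : ℕ → ℝ) (lam lamA cs ca η : ℝ) (V : ℕ → ℝ) : Prop where
  eq : ∀ τ, V τ = matrixValue (bellman g lam lamA cs ca η V τ)
  bdd : ∃ b, ∀ τ, |V τ| ≤ b

namespace IsValueFn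

variable {g : ℕ → ℝ} {lam lamA cs ca η : ℝ} {V : ℕ → ℝ}

lemma le_of_forall_le_add_pow {x y b : ℝ} (hη0 : 0 ≤ η) (hη1 : η < 1)
    (h : ∀ n : ℕ, x ≤ y + η ^ n * b) : x ≤ y := by
  have hlim : Tendsto (fun n : ℕ => y + η ^ n * b) atTop (𝓝 y) := by
    simpa using ((tendsto_pow_atTop_nhds_zero_of_lt_one hη0 hη1).mul_const b).const_add y
  exact ge_of_tendsto' hlim h

/-- Boundedness gives the inequality up to the error `2 * b`, and each use of the Shapley equation
shrinks the error by the factor `η`. -/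
lemma monotone (hV : IsValueFn g lam lamA cs ca η V) (hg : Monotone g) (hlamA : 0 ≤ lamA)
    (hlt : lamA ≤ lam) (hlam : lam ≤ 1) (hη0 : 0 ≤ η) (hη1 : η < 1) : Monotone V := by
  obtain ⟨b, hb⟩ := hV.bdd
  have hb0 : 0 ≤ b := (abs_nonneg _).trans (hb 0)
  have key : ∀ n : ℕ, ∀ τ τ', τ ≤ τ' → V τ ≤ V τ' + η ^ n * (2 * b) := by
    intro n
    induction n with
    | zero =>
      intro τ τ' _
      have h1 := (abs_le.1 (hb τ)).2
      have h2 := (abs_le.1 (hb τ')).1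
      linarith
    | succ n ih =>
      intro τ τ' h
      rw [hV.eq τ, hV.eq τ']
      refine matrixValue_le_add fun ν a => ?_
      have hnn : 0 ≤ η ^ (n + 1) * (2 * b) := by positivity
      refine bellman_le_add hlamA hlt hlam (by linarith) ?_
      have h1 := mul_le_mul_of_nonneg_left (ih (τ + 1) (τ' + 1) (by omega)) hη0
      have h2 := hg (show τ + 1 ≤ τ' + 1 by omega)
      rw [pow_succ]
      linarith
  exact fun τ τ' h => le_of_forall_le_add_pow hη0 hη1 fun n => key n τ τ' h

/-- The bound solves `c = G + |cs| + |ca| + η * c`. Unlike the bound in `IsValueFn`, it depends only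
on the data, hence is uniform in the truncation level. -/
lemma abs_le_div (hV : IsValueFn g lam lamA cs ca η V) (hlamA : 0 ≤ lamA)
    (hlt : lamA ≤ lam) (hlam : lam ≤ 1) (hη0 : 0 ≤ η) (hη1 : η < 1) {G : ℝ}
    (hg : ∀ τ, |g τ| ≤ G) (τ : ℕ) : |V τ| ≤ (G + |cs| + |ca|) / (1 - η) := by
  obtain ⟨b, hb⟩ := hV.bdd
  have hb0 : 0 ≤ b := (abs_nonneg _).trans (hb 0)
  have hη : 0 < 1 - η := by linarith
  set c := (G + |cs| + |ca|) / (1 - η) with hc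
  have hcm : c * (1 - η) = G + |cs| + |ca| := div_mul_cancel₀ _ hη.ne'
  have hc0 : 0 ≤ c := by
    have := (abs_nonneg _).trans (hg 0)
    positivity
  have key : ∀ n : ℕ, ∀ τ, |V τ| ≤ c + η ^ n * b := by
    intro n
    induction n with
    | zero => intro τ; have := hb τ; simp only [pow_zero, one_mul]; linarith
    | succ n ih =>
      intro τ
      rw [hV.eq τ]
      have hstep : ∀ t, |g t + η * V t| ≤ G + η * (c + η ^ n * b) := fun t => by
        refine (abs_add_le _ _).trans (add_le_add (hg t) ?_)
        rw [abs_mul, abs_of_nonneg hη0]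
        exact mul_le_mul_of_nonneg_left (ih t) hη0
      refine (abs_matrixValue_le fun ν a =>
        abs_bellman_le hlamA hlt hlam (hstep 0) (hstep (τ + 1))).trans ?_
      rw [pow_succ]
      linarith
  exact le_of_forall_le_add_pow hη0 hη1 fun n => key n τ

end IsValueFn

lemma min_pred_lt {N : ℕ} (hN : 1 ≤ N) (τ : ℕ) : min τ (N - 1) < N := by omega

/-- The equilibrium values of the truncated game, extended to all holding times. -/
def truncValue {N : ℕ} (hN : 1 ≤ N) (Qf : Fin N → Bool → Bool → ℝ) (τ : ℕ) : ℝ :=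
  matrixValue (Qf ⟨min τ (N - 1), min_pred_lt hN τ⟩)

/-! ### The truncated game as a stopped-cost game; existence and uniqueness of its Q-function -/

section NashQ

variable {g : ℕ → ℝ} {lam lamA cs ca η : ℝ} {N : ℕ}

/-- The truncated game is the untruncated one for the stopped cost function. -/
lemma IsNashQ.eq_bellman {Qf : Fin N → Bool → Bool → ℝ}
    (hQ : IsNashQ g lam lamA cs ca η Qf) (hN : 1 ≤ N) (τ : ℕ) :
    Qf ⟨min τ (N - 1), min_pred_lt hN τ⟩
      = bellman (fun t => g (min t (N - 1))) lam lamA cs ca η (truncValue hN Qf) τ := by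
  have e : min (min τ (N - 1) + 1) (N - 1) = min (τ + 1) (N - 1) := by omega
  funext ν a
  rw [hQ]
  cases ν
  · simp [truncNext, immCost, bern, recvProb, bellman, truncValue, e]
    ring
  · simp [truncNext, immCost, bern, bellman, truncValue, e]
    ring

lemma IsNashQ.isValueFn {Qf : Fin N → Bool → Bool → ℝ}
    (hQ : IsNashQ g lam lamA cs ca η Qf) (hN : 1 ≤ N) :
    IsValueFn (fun t => g (min t (N - 1))) lam lamA cs ca η (truncValue hN Qf) where
  eq τ := by rw [← hQ.eq_bellman hN τ]; rfl
  bdd := by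
    refine ⟨∑ i, |matrixValue (Qf i)|, fun τ => ?_⟩
    exact Finset.single_le_sum (f := fun i => |matrixValue (Qf i)|)
      (fun i _ => abs_nonneg _) (Finset.mem_univ _)

/-- The operator whose fixed points are the Nash Q-functions. -/
def nashOp (g : ℕ → ℝ) (lam lamA cs ca η : ℝ) (Qf : Fin N → Bool → Bool → ℝ) :
    Fin N → Bool → Bool → ℝ := fun τ ν a =>
  ∑ γ : Bool, bern (recvProb lam lamA ν a) γ *
    (immCost g cs ca (truncNext τ ν γ) ν a + η * matrixValue (Qf (truncNext τ ν γ)))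

lemma isNashQ_iff {Qf : Fin N → Bool → Bool → ℝ} :
    IsNashQ g lam lamA cs ca η Qf ↔ nashOp g lam lamA cs ca η Qf = Qf := by
  simp only [IsNashQ, funext_iff, nashOp, eq_comm]

lemma dist_matrixValue_le (M M' : Bool → Bool → ℝ) :
    dist (matrixValue M) (matrixValue M') ≤ dist M M' :=
  abs_matrixValue_sub_le fun ν a => (dist_le_pi_dist (M ν) (M' ν) a).trans (dist_le_pi_dist M M' ν)

lemma contractingWith_nashOp (hlamA : 0 ≤ lamA) (hlt : lamA ≤ lam) (hlam : lam ≤ 1)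
    (hη0 : 0 ≤ η) (hη1 : η < 1) :
    ContractingWith ⟨η, hη0⟩ (nashOp (N := N) g lam lamA cs ca η) := by
  refine ⟨by exact_mod_cast hη1, LipschitzWith.of_dist_le_mul fun Q₁ Q₂ => ?_⟩
  have hd : 0 ≤ η * dist Q₁ Q₂ := mul_nonneg hη0 dist_nonneg
  refine (dist_pi_le_iff hd).2 fun τ => (dist_pi_le_iff hd).2 fun ν => (dist_pi_le_iff hd).2
    fun a => ?_
  have hb := fun γ => bern_nonneg (recvProb_nonneg hlamA hlt ν a) (recvProb_le_one hlt hlam ν a) γ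
  rw [Real.dist_eq]
  unfold nashOp
  rw [← Finset.sum_sub_distrib]
  calc _ ≤ ∑ γ, bern (recvProb lam lamA ν a) γ * (η * dist Q₁ Q₂) := by
        refine (Finset.abs_sum_le_sum_abs _ _).trans (Finset.sum_le_sum fun γ _ => ?_)
        rw [← mul_sub, abs_mul, abs_of_nonneg (hb γ), add_sub_add_left_eq_sub, ← mul_sub, abs_mul,
          abs_of_nonneg hη0]
        exact mul_le_mul_of_nonneg_left (mul_le_mul_of_nonneg_left
          ((dist_matrixValue_le _ _).trans (dist_le_pi_dist Q₁ Q₂ _)) hη0) (hb γ)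
    _ = η * dist Q₁ Q₂ := by rw [← Finset.sum_mul, sum_bern, one_mul]

lemma existsUnique_isNashQ (hlamA : 0 ≤ lamA) (hlt : lamA ≤ lam) (hlam : lam ≤ 1)
    (hη0 : 0 ≤ η) (hη1 : η < 1) (N : ℕ) :
    ∃! Qf : Fin N → Bool → Bool → ℝ, IsNashQ g lam lamA cs ca η Qf := by
  have hc := contractingWith_nashOp (N := N) (g := g) (cs := cs) (ca := ca) hlamA hlt hlam hη0 hη1
  simp only [isNashQ_iff]
  exact ⟨_, hc.fixedPoint_isFixedPt, fun _ h => hc.fixedPoint_unique h⟩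

end NashQ

lemma exists_isTruncatedPair {N : ℕ} (Qf : Fin N → Bool → Bool → ℝ) :
    ∃ σc σa : ℕ → unitInterval, IsTruncatedPair Qf σc σa := by
  choose p hp using fun τ => exists_isMinOn_iSup_payoff (Qf τ)
  choose q hq using fun τ => exists_isMaxOn_iInf_payoff (Qf τ)
  refine ⟨fun τ => if h : τ + 1 < N then p ⟨τ, by omega⟩ else 1,
    fun τ => if h : τ + 1 < N then q ⟨τ, by omega⟩ else 1, fun τ hτ => ?_, fun τ hτ => ?_⟩
  · simp only [hτ, dif_pos]
    exact ⟨hp τ, hq τ⟩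
  · simp [not_lt.2 hτ]

/-! ### Error bounds for the truncated policies -/

section Weights

variable {lamA η r C : ℝ}

/-- Weights which dominate the expected discounted future cost `C * r ^ τ` beyond the holding
time `T`, if transmissions take place with certainty from the holding time `T₀` on. -/
lemma exists_weight (hη0 : 0 < η) (hη1 : η < 1) (hlamA0 : 0 ≤ lamA) (hlamA1 : lamA < 1)
    (hr : 1 ≤ r) (hηr : η * (1 - lamA) * r < 1) (hC : 0 ≤ C) (T₀ : ℕ) :
    ∃ k : ℝ, ∀ T, T₀ ≤ T → ∃ w : ℕ → ℝ, (∀ τ, 0 ≤ w τ) ∧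
      (∀ τ < T₀, η * w 0 ≤ w τ ∧ η * w (τ + 1) ≤ w τ) ∧
      (∀ τ < T, ∀ p, lamA ≤ p → p ≤ 1 → η * (p * w 0 + (1 - p) * w (τ + 1)) ≤ w τ) ∧
      (∀ τ, T ≤ τ → ∀ p, lamA ≤ p → p ≤ 1 →
        C * r ^ (τ + 1) + η * (p * w 0 + (1 - p) * w (τ + 1)) ≤ w τ) ∧
      w 0 = k * (η * (1 - lamA) * r) ^ T + C * r / (1 - η * (1 - lamA) * r) *
        (η * (1 - lamA) * r) ^ T := by
  set q := η * (1 - lamA) with hq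
  have hl : 0 < 1 - lamA := by linarith
  have hq0 : 0 < q := mul_pos hη0 hl
  have hq1 : q ≤ 1 := by rw [hq]; nlinarith
  have hr0 : 0 < r := by linarith
  set b := C * r / (1 - q * r) with hb
  have hd : 0 < 1 - q * r := by linarith
  have hb0 : 0 ≤ b := by positivity
  have hbd : b * (1 - q * r) = C * r := div_mul_cancel₀ _ hd.ne'
  have hη : 0 < 1 - η := by linarith
  refine ⟨η * b / (1 - η) / q ^ T₀, fun T hT => ?_⟩
  -- Beyond `T` the profile follows the growth `r ^ τ`; below `T` it loses a factor `q`, the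
  -- discounted failure probability, for each missing step. The constant `b` solves `C * r + b * q *
  -- r = b`, which pays the running cost from `T` on.
  set φ : ℕ → ℝ := fun τ => r ^ max τ T * q ^ (T - τ) with hφ
  have hφ0 : ∀ τ, 0 < φ τ := fun τ => by positivity
  have hφlt : ∀ τ < T, q * φ (τ + 1) = φ τ := fun τ hτ => by
    have h1 : T - τ = (T - (τ + 1)) + 1 := by omega
    have h2 : max τ T = T := by omega
    have h3 : max (τ + 1) T = T := by omega
    simp only [hφ, h1, h2, h3, pow_succ]
    ring
  have hφge : ∀ τ, T ≤ τ → φ τ = r ^ τ := fun τ hτ => by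
    simp [hφ, Nat.sub_eq_zero_of_le hτ, hτ]
  have hφmono : ∀ {i j}, i ≤ j → φ i ≤ φ j := fun {i j} hij =>
    mul_le_mul (pow_le_pow_right₀ hr (by omega))
      (pow_le_pow_of_le_one hq0.le hq1 (by omega)) (by positivity) (by positivity)
  -- The constant part solves `η * (m + b * φ T₀) = m`. It covers the states below `T₀`, where no
  -- transmission is assured, and leaves room for a return to `0` elsewhere.
  set m := η * b * φ T₀ / (1 - η) with hm
  have hmd : m * (1 - η) = η * b * φ T₀ := div_mul_cancel₀ _ hη.ne'
  have hm0 : 0 ≤ m := by have := hφ0 T₀; positivity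
  have hηb : 0 ≤ η * b := by positivity
  have hsmall : ∀ i ≤ T₀, η * (m + b * φ i) ≤ m := fun i hi => by
    have := mul_le_mul_of_nonneg_left (hφmono hi) hηb
    linarith
  have hstep : ∀ τ p, lamA ≤ p → p ≤ 1 →
      η * (p * (m + b * φ 0) + (1 - p) * (m + b * φ (τ + 1))) ≤ m + b * (q * φ (τ + 1)) := by
    intro τ p hp hp1
    have h0 : η * b * φ 0 ≤ m * (1 - η) := by
      have := hsmall 0 (Nat.zero_le _)
      linarith
    have h1 : p * (η * b * φ 0) ≤ 1 * (η * b * φ 0) := mul_le_mul_of_nonneg_right hp1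
      (mul_nonneg hηb (hφ0 0).le)
    have h2 : (1 - p) * (η * b * φ (τ + 1)) ≤ (1 - lamA) * (η * b * φ (τ + 1)) :=
      mul_le_mul_of_nonneg_right (by linarith) (mul_nonneg hηb (hφ0 _).le)
    have e : b * (q * φ (τ + 1)) = (1 - lamA) * (η * b * φ (τ + 1)) := by rw [hq]; ring
    rw [e]
    linarith
  refine ⟨fun τ => m + b * φ τ, fun τ => ?_, fun τ hτ => ⟨?_, ?_⟩, fun τ hτ p hp hp1 => ?_,
    fun τ hτ p hp hp1 => ?_, ?_⟩
  · have := hφ0 τ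
    positivity
  · exact (hsmall 0 (Nat.zero_le _)).trans (le_add_of_nonneg_right (mul_nonneg hb0 (hφ0 _).le))
  · exact (hsmall (τ + 1) hτ).trans (le_add_of_nonneg_right (mul_nonneg hb0 (hφ0 _).le))
  · have := hstep τ p hp hp1
    rwa [hφlt τ hτ] at this
  · refine (add_le_add_right (hstep τ p hp hp1) _).trans ?_
    simp only [hφge (τ + 1) (by omega), hφge τ hτ, pow_succ]
    linear_combination (-(r ^ τ)) * hbd
  · have h0 : φ 0 = (q * r) ^ T := by simp [hφ, mul_pow, mul_comm]
    -- Only `T - T₀` factors `q` are available from `T₀` on; the missing `q ^ T₀` does not depend on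
    -- `T` and goes into `k`.
    have h1 : φ T₀ * q ^ T₀ = (q * r) ^ T := by
      simp only [hφ, max_eq_right hT, mul_assoc, ← pow_add, Nat.sub_add_cancel hT, mul_pow]
      ring
    simp only [h0]
    rw [hm, ← h1]
    field_simp

end Weights

section Errors

variable {g : ℕ → ℝ} {lam lamA cs ca η : ℝ}

lemma IsTruncatedPair.payoff_le {N : ℕ} (hN : 1 ≤ N) {Qf : Fin N → Bool → Bool → ℝ}
    (hQ : IsNashQ g lam lamA cs ca η Qf) {σc σa : ℕ → unitInterval}
    (hσ : IsTruncatedPair Qf σc σa) {τ : ℕ} (hτ : τ + 1 < N) (q : unitInterval) :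
    payoff (bellman (fun t => g (min t (N - 1))) lam lamA cs ca η (truncValue hN Qf) τ) (σc τ) q
      ≤ truncValue hN Qf τ := by
  have hmin : min τ (N - 1) = τ := by omega
  have h := payoff_le_matrixValue_of_minmax (hσ.1 ⟨τ, by omega⟩ hτ).1 q
  rw [← hQ.eq_bellman hN τ]
  simpa only [truncValue, hmin] using h

lemma IsTruncatedPair.le_payoff {N : ℕ} (hN : 1 ≤ N) {Qf : Fin N → Bool → Bool → ℝ}
    (hQ : IsNashQ g lam lamA cs ca η Qf) {σc σa : ℕ → unitInterval}
    (hσ : IsTruncatedPair Qf σc σa) {τ : ℕ} (hτ : τ + 1 < N) (p : unitInterval) :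
    truncValue hN Qf τ ≤ payoff
      (bellman (fun t => g (min t (N - 1))) lam lamA cs ca η (truncValue hN Qf) τ) p (σa τ) := by
  have hmin : min τ (N - 1) = τ := by omega
  have h := matrixValue_le_payoff_of_maxmin (hσ.1 ⟨τ, by omega⟩ hτ).2 p
  rw [← hQ.eq_bellman hN τ]
  simpa only [truncValue, hmin] using h

lemma IsTruncatedPair.eq_one_of_dominant {N : ℕ} (hN : 1 ≤ N) {Qf : Fin N → Bool → Bool → ℝ}
    (hQ : IsNashQ g lam lamA cs ca η Qf) {σc σa : ℕ → unitInterval}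
    (hσ : IsTruncatedPair Qf σc σa) {τ : ℕ}
    (hd : ∀ a, bellman (fun t => g (min t (N - 1))) lam lamA cs ca η (truncValue hN Qf) τ true a
      < bellman (fun t => g (min t (N - 1))) lam lamA cs ca η (truncValue hN Qf) τ false a) :
    σc τ = 1 := by
  rcases lt_or_ge (τ + 1) N with hτ | hτ
  · have hmin : min τ (N - 1) = τ := by omega
    rw [← hQ.eq_bellman hN τ] at hd
    simp only [hmin] at hd
    exact minmax_eq_one_of_dominant (hσ.1 ⟨τ, by omega⟩ hτ).1 hd
  · exact (hσ.2 τ hτ).1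

/-- Transmitting saves at least `lamA` times the increase of `g + η * V` from `0` to `τ + 1`, and
monotonicity of `V` lets the gap in `g` alone pay for `cs`. -/
lemma bellman_lt_of_cost_gap {V : ℕ → ℝ} (hV : Monotone V) (hlamA : 0 ≤ lamA) (hlt : lamA ≤ lam)
    (hη0 : 0 ≤ η) {τ : ℕ} (hgap : |cs| < lamA * (g (τ + 1) - g 0)) (a : Bool) :
    bellman g lam lamA cs ca η V τ true a < bellman g lam lamA cs ca η V τ false a := by
  have hv := mul_le_mul_of_nonneg_left (hV (Nat.zero_le (τ + 1))) hη0
  have hpos : 0 < g (τ + 1) - g 0 := by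
    by_contra hneg
    have := mul_nonpos_of_nonneg_of_nonpos hlamA (not_lt.1 hneg)
    have := abs_nonneg cs
    linarith
  have hcs := le_abs_self cs
  have hD := mul_nonneg hlamA (sub_nonneg.2 hv)
  have hE : 0 ≤ (lam - lamA) * ((g (τ + 1) + η * V (τ + 1)) - (g 0 + η * V 0)) :=
    mul_nonneg (by linarith) (by linarith)
  cases a <;> simp [bellman, recvProb] <;> linarith

/-- Against a transmission, an attack lowers the reception probability by `lam - lamA`, which is
worth at least `ca`. -/
lemma bellman_le_of_cost_gap {V : ℕ → ℝ} (hV : Monotone V) (hlt : lamA ≤ lam)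
    (hη0 : 0 ≤ η) {τ : ℕ} (hgap : |ca| ≤ (lam - lamA) * (g (τ + 1) - g 0)) :
    bellman g lam lamA cs ca η V τ true false ≤ bellman g lam lamA cs ca η V τ true true := by
  have hv := mul_le_mul_of_nonneg_left (hV (Nat.zero_le (τ + 1))) hη0
  have hca := le_abs_self ca
  have hD := mul_nonneg (sub_nonneg.2 hlt) (sub_nonneg.2 hv)
  simp [bellman, recvProb]
  linarith

/-- Every policy pair costs at least what the action costs may save. -/
lemma neg_le_cost (hg : ∀ τ, 0 ≤ g τ) (hlamA : 0 ≤ lamA) (hlt : lamA ≤ lam) (hlam : lam ≤ 1)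
    (hη0 : 0 ≤ η) (hη1 : η < 1) (πc πa : Policy) :
    ((-((|cs| + |ca|) / (1 - η)) : ℝ) : EReal) ≤ cost g lam lamA cs ca η πc πa := by
  have hη : 0 < 1 - η := by linarith
  set c := (|cs| + |ca|) / (1 - η) with hc
  have hcm : c * (1 - η) = |cs| + |ca| := div_mul_cancel₀ _ hη.ne'
  refine le_cost_of_subsolution (L := fun _ => -c) hlamA hlt hlam hη0 hη1 (fun _ => le_rfl)
    fun h => ?_
  have key : ∀ ν a, (fun _ _ => 0 : Bool → Bool → ℝ) ν a
      ≤ bellman g lam lamA cs ca η (fun _ => -c) (holdTime h) ν a + c := fun ν a => by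
    have hp0 := recvProb_nonneg hlamA hlt ν a
    have hp1 : 0 ≤ 1 - recvProb lam lamA ν a := by
      have := recvProb_le_one hlt hlam ν a
      linarith
    have hcs : -|cs| ≤ if ν then cs else 0 := by split_ifs <;> simp [neg_abs_le]
    have hca : (if a then ca else 0) ≤ |ca| := by split_ifs <;> simp [le_abs_self]
    have h1 := mul_nonneg hp0 (hg 0)
    have h2 := mul_nonneg hp1 (hg (holdTime h + 1))
    simp only [bellman]
    linarith
  have := payoff_le_payoff_add (πc h).2.1 (πc h).2.2 (πa h).2.1 (πa h).2.2 key
  rw [payoff_zero] at this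
  linarith

/-- If the controller transmits at all long holding times, then the cost is bounded. -/
lemma exists_cost_le_of_transmit (hmono : Monotone g) (hlamA : 0 ≤ lamA)
    (hlt : lamA < lam) (hlam : lam ≤ 1) (hη0 : 0 < η) (hη1 : η < 1) {r C : ℝ} (hr : 1 ≤ r)
    (hηr : η * (1 - lamA) * r < 1) (hC : 0 ≤ C) (hgrow : ∀ τ, g τ ≤ C * r ^ τ) (T : ℕ) :
    ∃ b : ℝ, ∀ σc : ℕ → unitInterval, (∀ τ, T ≤ τ → σc τ = 1) → ∀ πa : Policy,
      cost g lam lamA cs ca η (stationary σc) πa ≤ (b : EReal) := by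
  obtain ⟨k, hk⟩ := exists_weight hη0 hη1 hlamA (hlt.trans_le hlam) hr hηr hC T
  obtain ⟨w, hw0, hw1, -, hw3, -⟩ := hk T le_rfl
  have hη : 0 < 1 - η := by linarith
  have hr0 : 0 < r := by linarith
  -- The constant pays the action costs everywhere and the running cost at `τ < T`; from `T` on the
  -- weight pays the running cost.
  set c := (|cs| + |ca| + C * r ^ T) / (1 - η) with hc
  have hcm : c * (1 - η) = |cs| + |ca| + C * r ^ T := div_mul_cancel₀ _ hη.ne'
  have hc0 : 0 ≤ C * r ^ T := by positivity
  refine ⟨c + w 0, fun σc hσ πa => ?_⟩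
  refine cost_le_of_supersolution (H := fun τ => c + w τ) (c := c) hlamA hlt.le hlam hη0.le hη1
    (fun τ => le_add_of_nonneg_right (hw0 τ)) fun h => ?_
  set τ := holdTime h with hτ
  have hact : ∀ ν a : Bool, (if ν then cs else 0) - (if a then ca else 0) ≤ |cs| + |ca| := by
    intro ν a
    have hcs : (if ν then cs else 0) ≤ |cs| := by split_ifs <;> simp [le_abs_self]
    have hca : -|ca| ≤ (if a then ca else 0) := by split_ifs <;> simp [neg_abs_le]
    linarith
  have hg01 : g 0 ≤ g (τ + 1) := hmono (Nat.zero_le _)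
  have hbell : ∀ ν a, bellman g lam lamA cs ca η (fun τ => c + w τ) τ ν a ≤ g (τ + 1)
      + η * (recvProb lam lamA ν a * w 0 + (1 - recvProb lam lamA ν a) * w (τ + 1))
      + η * c + |cs| + |ca| := fun ν a => by
    have hp0 := recvProb_nonneg hlamA hlt.le ν a
    have := hact ν a
    have := mul_le_mul_of_nonneg_left hg01 hp0
    simp only [bellman]
    linarith
  rcases lt_or_ge τ T with hτT | hτT
  · have key : ∀ ν a, bellman g lam lamA cs ca η (fun τ => c + w τ) τ ν a
        ≤ (fun _ _ => 0 : Bool → Bool → ℝ) ν a + (c + w τ) := fun ν a => by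
      have hp0 := recvProb_nonneg hlamA hlt.le ν a
      have hp1 : 0 ≤ 1 - recvProb lam lamA ν a := by
        have := recvProb_le_one hlt.le hlam ν a
        linarith
      have h1 := mul_le_mul_of_nonneg_left (hw1 τ hτT).1 hp0
      have h2 := mul_le_mul_of_nonneg_left (hw1 τ hτT).2 hp1
      have h3 : g (τ + 1) ≤ C * r ^ T := (hgrow _).trans
        (mul_le_mul_of_nonneg_left (pow_le_pow_right₀ hr hτT) hC)
      have := hbell ν a
      linarith
    have := payoff_le_payoff_add (σc τ).2.1 (σc τ).2.2 (πa h).2.1 (πa h).2.2 key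
    rwa [payoff_zero, zero_add] at this
  · have key : ∀ a, bellman g lam lamA cs ca η (fun τ => c + w τ) τ true a ≤ c + w τ := fun a => by
      have hp : lamA ≤ recvProb lam lamA true a := by cases a <;> simp [recvProb, hlt.le]
      have h1 := hw3 τ hτT _ hp (recvProb_le_one hlt.le hlam true a)
      have h2 := hgrow (τ + 1)
      have := hbell true a
      linarith
    have hs : stationary σc h = 1 := hσ τ hτT
    rw [hs, payoff_eq_right, payoff_eq, payoff_eq]
    refine convex_comb_le (πa h).2.1 (πa h).2.2 ?_ ?_
    · simpa using key false
    · simpa using key true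

/-- Near-optimality of all truncated pairs for the truncation level `N`, with error `e`. -/
def TruncErrorLE (g : ℕ → ℝ) (lam lamA cs ca η : ℝ) (N : ℕ) (e : ℝ) : Prop :=
  ∀ (hN : 1 ≤ N) (Qf : Fin N → Bool → Bool → ℝ), IsNashQ g lam lamA cs ca η Qf →
    ∀ σc σa : ℕ → unitInterval, IsTruncatedPair Qf σc σa →
      (∀ πa, cost g lam lamA cs ca η (stationary σc) πa
        ≤ ((truncValue hN Qf 0 + e : ℝ) : EReal)) ∧
      ∀ πc, ((truncValue hN Qf 0 - e : ℝ) : EReal)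
        ≤ cost g lam lamA cs ca η πc (stationary σa)

/-- The truncation error decays geometrically for a bounded cost function. -/
lemma exists_truncErrorLE_of_bounded (hlamA : 0 ≤ lamA) (hlt : lamA ≤ lam) (hlam : lam ≤ 1)
    (hη0 : 0 < η) (hη1 : η < 1) {G : ℝ} (hG : ∀ τ, |g τ| ≤ G) :
    ∃ κ : ℝ, ∀ N, TruncErrorLE g lam lamA cs ca η N (κ * η ^ (N - 1)) := by
  have hη : 0 < 1 - η := by linarith
  have hG0 : 0 ≤ G := (abs_nonneg _).trans (hG 0)
  set b := (G + |cs| + |ca|) / (1 - η) with hb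
  have hb0 : 0 ≤ b := by positivity
  -- Chosen so that `V ± κ` satisfies the Bellman inequality for arbitrary actions, whatever is
  -- played at the default states.
  set κ := (G + η * b + |cs| + |ca| + b) / (1 - η) with hκ
  have hκm : κ * (1 - η) = G + η * b + |cs| + |ca| + b := div_mul_cancel₀ _ hη.ne'
  have hκ0 : 0 ≤ κ := by positivity
  refine ⟨κ, fun N hN Qf hQ σc σa hσ => ?_⟩
  have hVb : ∀ τ, |truncValue hN Qf τ| ≤ b := (hQ.isValueFn hN).abs_le_div hlamA hlt hlam
    hη0.le hη1 (fun τ => hG _)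
  set V := truncValue hN Qf with hV
  -- The exponent is the least number of periods before level `N - 1` can be reached from `τ`.
  set w : ℕ → ℝ := fun τ => κ * η ^ (N - 1 - τ) with hw
  have hw0 : ∀ τ, 0 ≤ w τ := fun τ => by positivity
  have hwκ : ∀ τ, w τ ≤ κ := fun τ => mul_le_of_le_one_right hκ0 (pow_le_one₀ hη0.le hη1.le)
  have hwlt : ∀ {τ}, τ + 1 < N → η * w 0 ≤ w τ ∧ η * w (τ + 1) ≤ w τ := by
    intro τ hτ
    have e : ∀ i, η * w i = κ * η ^ (N - 1 - i + 1) := fun i => by simp only [hw, pow_succ]; ring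
    simp only [e]
    exact ⟨mul_le_mul_of_nonneg_left (pow_le_pow_of_le_one hη0.le hη1.le (by omega)) hκ0,
      mul_le_mul_of_nonneg_left (pow_le_pow_of_le_one hη0.le hη1.le (by omega)) hκ0⟩
  have hwge : ∀ {τ}, N ≤ τ + 1 → w τ = κ := fun {τ} hτ => by
    simp [hw, show N - 1 - τ = 0 by omega]
  have hgV : ∀ t, |g t + η * V t| ≤ G + η * b := fun t => by
    refine (abs_add_le _ _).trans (add_le_add (hG t) ?_)
    rw [abs_mul, abs_of_pos hη0]
    exact mul_le_mul_of_nonneg_left (hVb t) hη0.le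
  have hbell : ∀ τ ν a, |bellman g lam lamA cs ca η V τ ν a| ≤ G + η * b + |cs| + |ca| :=
    fun τ ν a => abs_bellman_le hlamA hlt hlam (hgV 0) (hgV (τ + 1))
  have hηw : ∀ t, η * w t ≤ η * κ := fun t => mul_le_mul_of_nonneg_left (hwκ t) hη0.le
  constructor
  · intro πa
    have h0 : V 0 + κ * η ^ (N - 1) = (fun τ => V τ + w τ) 0 := by simp [hw]
    rw [h0]
    refine cost_le_of_supersolution (H := fun τ => V τ + w τ) (c := -b) hlamA hlt hlam hη0.le hη1
      (fun τ => by have := (abs_le.1 (hVb τ)).1; have := hw0 τ; linarith) fun h => ?_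
    set τ := holdTime h with hτ
    rcases lt_or_ge (τ + 1) N with hτN | hτN
    · refine (payoff_le_payoff_add (stationary σc h).2.1 (stationary σc h).2.2 (πa h).2.1
        (πa h).2.2 (c := w τ) fun ν a => ?_).trans
        (add_le_add_left (hσ.payoff_le hN hQ hτN (πa h)) _)
      refine bellman_le_add hlamA hlt hlam ?_ ?_
      · have := (hwlt hτN).1
        simp only [Nat.zero_min]
        linarith
      · have := (hwlt hτN).2
        simp only [show min (τ + 1) (N - 1) = τ + 1 by omega]
        linarith
    · have key : ∀ ν a, bellman g lam lamA cs ca η (fun τ => V τ + w τ) τ ν a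
          ≤ (fun _ _ => 0 : Bool → Bool → ℝ) ν a + (V τ + w τ) := fun ν a => by
        have h1 := bellman_le_add (cs := cs) (ca := ca) (g := g) (g' := g) (ν := ν) (a := a)
          (τ := τ) (τ' := τ) (η := η) (H := fun τ => V τ + w τ) (H' := V) hlamA hlt hlam
          (c := η * κ) (by linarith [hηw 0]) (by linarith [hηw (τ + 1)])
        have h2 := (abs_le.1 (hbell τ ν a)).2
        have h3 := (abs_le.1 (hVb τ)).1
        rw [hwge hτN]
        linarith
      have := payoff_le_payoff_add (stationary σc h).2.1 (stationary σc h).2.2 (πa h).2.1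
        (πa h).2.2 key
      rwa [payoff_zero, zero_add] at this
  · intro πc
    have h0 : V 0 - κ * η ^ (N - 1) = (fun τ => V τ - w τ) 0 := by simp [hw]
    rw [h0]
    refine le_cost_of_subsolution (L := fun τ => V τ - w τ) (c := b) hlamA hlt hlam hη0.le hη1
      (fun τ => by have := (abs_le.1 (hVb τ)).2; have := hw0 τ; linarith) fun h => ?_
    set τ := holdTime h with hτ
    rcases lt_or_ge (τ + 1) N with hτN | hτN
    · rw [sub_le_iff_le_add]
      refine (hσ.le_payoff hN hQ hτN (πc h)).trans
        (payoff_le_payoff_add (πc h).2.1 (πc h).2.2 (stationary σa h).2.1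
        (stationary σa h).2.2 (c := w τ) fun ν a => ?_)
      refine bellman_le_add hlamA hlt hlam ?_ ?_
      · have := (hwlt hτN).1
        simp only [Nat.zero_min]
        linarith
      · have := (hwlt hτN).2
        simp only [show min (τ + 1) (N - 1) = τ + 1 by omega]
        linarith
    · have key : ∀ ν a, (fun _ _ => 0 : Bool → Bool → ℝ) ν a
          ≤ bellman g lam lamA cs ca η (fun τ => V τ - w τ) τ ν a + -(V τ - w τ) := fun ν a => by
        have h1 := bellman_le_add (cs := cs) (ca := ca) (g := g) (g' := g) (ν := ν) (a := a)
          (τ := τ) (τ' := τ) (η := η) (H' := fun τ => V τ - w τ) (H := V) hlamA hlt hlam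
          (c := η * κ) (by linarith [hηw 0]) (by linarith [hηw (τ + 1)])
        have h2 := (abs_le.1 (hbell τ ν a)).1
        have h3 := (abs_le.1 (hVb τ)).2
        rw [hwge hτN]
        linarith
      have := payoff_le_payoff_add (πc h).2.1 (πc h).2.2 (stationary σa h).2.1
        (stationary σa h).2.2 key
      rw [payoff_zero] at this
      linarith

/-- The truncation error decays geometrically for a monotone cost function which has a large gap
at the holding time `T₀` and which does not grow too fast. -/
lemma exists_truncErrorLE_of_gap (hg : ∀ τ, 0 ≤ g τ) (hmono : Monotone g) (hlamA : 0 ≤ lamA)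
    (hlt : lamA < lam) (hlam : lam ≤ 1) (hη0 : 0 < η) (hη1 : η < 1) {r C : ℝ} (hr : 1 ≤ r)
    (hηr : η * (1 - lamA) * r < 1) (hC : 0 ≤ C) (hgrow : ∀ τ, g τ ≤ C * r ^ τ) {T₀ : ℕ}
    (hcs : |cs| < lamA * (g (T₀ + 1) - g 0))
    (hca : |ca| ≤ (lam - lamA) * (g (T₀ + 1) - g 0)) :
    ∃ κ : ℝ, 0 ≤ κ ∧ ∀ N, T₀ + 2 ≤ N →
      TruncErrorLE g lam lamA cs ca η N (κ * (η * (1 - lamA) * r) ^ (N - 1)) := by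
  obtain ⟨k, hk⟩ := exists_weight hη0 hη1 hlamA (hlt.trans_le hlam) hr hηr hC T₀
  have hq0 : 0 < η * (1 - lamA) * r :=
    mul_pos (mul_pos hη0 (by linarith)) (by linarith)
  set κ := k + C * r / (1 - η * (1 - lamA) * r) with hκ
  have hwκ : ∀ T, ∀ x : ℝ, x = k * (η * (1 - lamA) * r) ^ T
      + C * r / (1 - η * (1 - lamA) * r) * (η * (1 - lamA) * r) ^ T →
      x = κ * (η * (1 - lamA) * r) ^ T := fun T x hx => by rw [hx, hκ]; ring
  have hκ0 : 0 ≤ κ := by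
    obtain ⟨w, hw0, -, -, -, hw4⟩ := hk T₀ le_rfl
    have h := hw0 0
    rw [hwκ _ _ hw4] at h
    exact nonneg_of_mul_nonneg_left h (pow_pos hq0 _)
  refine ⟨κ, hκ0, fun N hTN hN Qf hQ σc σa hσ => ?_⟩
  obtain ⟨w, hw0, hw1, hw2, hw3, hw4⟩ := hk (N - 1) (by omega)
  have hw4' := hwκ _ _ hw4
  set gN : ℕ → ℝ := fun t => g (min t (N - 1)) with hgN
  have hgNmono : Monotone gN := fun i j hij => hmono (by omega)
  have hgNle : ∀ t, gN t ≤ g t := fun t => hmono (min_le_left _ _)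
  have hVf := hQ.isValueFn hN
  have hVmono := hVf.monotone hgNmono hlamA hlt.le hlam hη0.le hη1
  obtain ⟨b, hVb⟩ := hVf.bdd
  set V := truncValue hN Qf with hV
  -- This uses `T₀ + 2 ≤ N`: the cap `N - 1` must not cut off the value of `g` at `T₀ + 1`.
  have hgap : ∀ τ, T₀ ≤ τ → g (T₀ + 1) - g 0 ≤ gN (τ + 1) - gN 0 := fun τ hτ => by
    have : g (T₀ + 1) ≤ gN (τ + 1) := hmono (by omega)
    simp only [hgN, Nat.zero_min] at this ⊢
    linarith
  have hdom : ∀ τ, T₀ ≤ τ → ∀ a, bellman gN lam lamA cs ca η V τ true a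
      < bellman gN lam lamA cs ca η V τ false a := fun τ hτ =>
    bellman_lt_of_cost_gap hVmono hlamA hlt.le hη0.le
      (hcs.trans_le (mul_le_mul_of_nonneg_left (hgap τ hτ) hlamA))
  constructor
  · intro πa
    have h0 : V 0 + κ * (η * (1 - lamA) * r) ^ (N - 1) = (fun τ => V τ + w τ) 0 := by
      simp only [hw4']
    rw [h0]
    refine cost_le_of_supersolution (H := fun τ => V τ + w τ) (c := -b) hlamA hlt.le hlam hη0.le hη1
      (fun τ => by have := (abs_le.1 (hVb τ)).1; have := hw0 τ; linarith) fun h => ?_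
    set τ := holdTime h with hτ
    rcases lt_or_ge τ T₀ with hτT | hτT
    · refine (payoff_le_payoff_add (stationary σc h).2.1 (stationary σc h).2.2 (πa h).2.1
        (πa h).2.2 (c := w τ) fun ν a => ?_).trans
        (add_le_add_left (hσ.payoff_le hN hQ (τ := τ) (by omega) (πa h)) _)
      refine bellman_le_add hlamA hlt.le hlam ?_ ?_
      · have := (hw1 τ hτT).1
        simp only [Nat.zero_min]
        linarith
      · have := (hw1 τ hτT).2
        simp only [show min (τ + 1) (N - 1) = τ + 1 by omega]
        linarith
    · have key : ∀ a, bellman g lam lamA cs ca η (fun τ => V τ + w τ) τ true a ≤ V τ + w τ := by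
        intro a
        have hp : lamA ≤ recvProb lam lamA true a := by cases a <;> simp [recvProb, hlt.le]
        have hp1 := recvProb_le_one hlt.le hlam true a
        have hval : bellman gN lam lamA cs ca η V τ true a ≤ V τ := by
          rw [hVf.eq τ]
          exact le_matrixValue_row (hdom τ hτT) a
        have hsplit : bellman g lam lamA cs ca η (fun τ => V τ + w τ) τ true a
            = bellman gN lam lamA cs ca η V τ true a
              + (1 - recvProb lam lamA true a) * (g (τ + 1) - gN (τ + 1))
              + η * (recvProb lam lamA true a * w 0
                + (1 - recvProb lam lamA true a) * w (τ + 1)) := by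
          simp only [bellman, hgN, Nat.zero_min]
          ring
        rw [hsplit]
        -- Below the cap the true and stopped costs agree. Above it the excess is at most `C * r ^
        -- (τ + 1)`, which the weight covers.
        rcases lt_or_ge τ (N - 1) with hτN | hτN
        · have h1 := hw2 τ hτN _ hp hp1
          have h2 : gN (τ + 1) = g (τ + 1) := by
            simp only [hgN, show min (τ + 1) (N - 1) = τ + 1 by omega]
          rw [h2, sub_self, mul_zero]
          linarith
        · have h1 := hw3 τ hτN _ hp hp1
          have h2 := hgrow (τ + 1)
          have h3 : 0 ≤ gN (τ + 1) := hg _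
          have h4 : (1 - recvProb lam lamA true a) * (g (τ + 1) - gN (τ + 1))
              ≤ g (τ + 1) - gN (τ + 1) :=
            mul_le_of_le_one_left (by linarith [hgNle (τ + 1)]) (by linarith)
          linarith
      -- Dominance forces the min-max action below level `N - 1`; from there on it is the default.
      have hs : stationary σc h = 1 := hσ.eq_one_of_dominant hN hQ (hdom τ hτT)
      rw [hs, payoff_eq_right, payoff_eq, payoff_eq]
      refine convex_comb_le (πa h).2.1 (πa h).2.2 ?_ ?_
      · simpa using key false
      · simpa using key true
  · intro πc
    have hle : ((V 0 - κ * (η * (1 - lamA) * r) ^ (N - 1) : ℝ) : EReal) ≤ (V 0 : EReal) :=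
      EReal.coe_le_coe_iff.2 (sub_le_self _ (mul_nonneg hκ0 (pow_nonneg hq0.le _)))
    refine hle.trans ?_
    -- No correction is needed for the attacker: `V` itself is a subsolution, because stopping only
    -- lowers the cost.
    refine le_cost_of_subsolution (c := b) hlamA hlt.le hlam hη0.le hη1
      (fun τ => (abs_le.1 (hVb τ)).2) fun h => ?_
    set τ := holdTime h with hτ
    have hbell : ∀ ν a, bellman gN lam lamA cs ca η V τ ν a
        ≤ bellman g lam lamA cs ca η V τ ν a + 0 := fun ν a =>
      bellman_le_add hlamA hlt.le hlam (by linarith [hgNle 0]) (by linarith [hgNle (τ + 1)])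
    rcases lt_or_ge (τ + 1) N with hτN | hτN
    · have := payoff_le_payoff_add (πc h).2.1 (πc h).2.2 (stationary σa h).2.1
        (stationary σa h).2.2 hbell
      rw [add_zero] at this
      exact (hσ.le_payoff hN hQ hτN (πc h)).trans this
    · have hτT : T₀ ≤ τ := by omega
      have hs : stationary σa h = 1 := (hσ.2 τ hτN).2
      have hatt := bellman_le_of_cost_gap (cs := cs) hVmono hlt.le hη0.le (τ := τ) (hca.trans
        (mul_le_mul_of_nonneg_left (hgap τ hτT) (sub_nonneg.2 hlt.le)))
      -- At the default states `(1, 1)` is a saddle point, so attacking with certainty secures at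
      -- least `V τ` against either action of the controller.
      have hval : V τ ≤ bellman gN lam lamA cs ca η V τ true true := by
        rw [hVf.eq τ]
        exact matrixValue_le_of_dominant hatt
      have h1 := hbell true true
      have h2 := hbell false true
      have h3 := hdom τ hτT true
      rw [hs, payoff_eq_left, payoff_eq, payoff_eq]
      refine le_convex_comb (πc h).2.1 (πc h).2.2 ?_ ?_ <;> simp <;> linarith

/-- The truncated pairs are equilibria up to an error which tends to zero. -/
lemma exists_truncErrorLE (hg : ∀ τ, 0 ≤ g τ) (hmono : Monotone g) (hlamA : 0 ≤ lamA)
    (hlt : lamA < lam) (hlam : lam ≤ 1) (hη0 : 0 < η) (hη1 : η < 1) {r C : ℝ} (hr : 1 ≤ r)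
    (hηr : η * (1 - lamA) * r < 1) (hC : 0 ≤ C) (hgrow : ∀ τ, g τ ≤ C * r ^ τ)
    (hbdd : lamA = 0 → ∃ G, ∀ τ, g τ ≤ G) :
    ∃ e : ℕ → ℝ, Tendsto e atTop (𝓝 0) ∧
      ∀ᶠ N in atTop, TruncErrorLE g lam lamA cs ca η N (e N) := by
  have hpow : ∀ {x : ℝ} (κ : ℝ), 0 ≤ x → x < 1 →
      Tendsto (fun N : ℕ => κ * x ^ (N - 1)) atTop (𝓝 0) := fun {x} κ hx0 hx1 => by
    simpa using ((tendsto_pow_atTop_nhds_zero_of_lt_one hx0 hx1).comp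
      (tendsto_sub_atTop_nat 1)).const_mul κ
  -- An unbounded `g` forces `lamA > 0` and eventually exceeds any threshold, so the gap required
  -- for dominance occurs at some `t`.
  by_cases hb : ∃ G, ∀ τ, g τ ≤ G
  · obtain ⟨G, hG⟩ := hb
    obtain ⟨κ, hκ⟩ := exists_truncErrorLE_of_bounded (cs := cs) (ca := ca) hlamA hlt.le hlam
      hη0 hη1 (fun τ => (abs_of_nonneg (hg τ)).le.trans (hG τ))
    exact ⟨_, hpow κ hη0.le hη1, Eventually.of_forall hκ⟩
  · have hl0 : 0 < lamA := lt_of_le_of_ne hlamA fun h => hb (hbdd h.symm)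
    have hl1 : 0 < lam - lamA := by linarith
    have hb' := hb
    push Not at hb'
    obtain ⟨t, ht⟩ := hb' (g 0 + (|cs| / lamA + |ca| / (lam - lamA)))
    have hT : g t ≤ g (t + 1) := hmono (Nat.le_succ t)
    have hgap : |cs| / lamA + |ca| / (lam - lamA) < g (t + 1) - g 0 := by linarith
    have hn1 : 0 ≤ |cs| / lamA := by positivity
    have hn2 : 0 ≤ |ca| / (lam - lamA) := by positivity
    have hcs : |cs| < lamA * (g (t + 1) - g 0) := by
      rw [mul_comm, ← div_lt_iff₀ hl0]
      linarith
    have hca : |ca| ≤ (lam - lamA) * (g (t + 1) - g 0) := by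
      rw [mul_comm, ← div_le_iff₀ hl1]
      linarith
    obtain ⟨κ, -, h⟩ := exists_truncErrorLE_of_gap hg hmono hlamA hlt hlam hη0 hη1 hr hηr hC hgrow
      hcs hca
    refine ⟨_, hpow κ ?_ hηr, eventually_atTop.2 ⟨t + 2, h⟩⟩
    exact mul_nonneg (mul_nonneg hη0.le (by linarith)) (by linarith)

/-- The truncated pairs have a finite cost and are approximate Nash equilibria. -/
theorem exists_tendsto_isApproxNash (hg : ∀ τ, 0 ≤ g τ) (hmono : Monotone g) (hlamA : 0 ≤ lamA)
    (hlt : lamA < lam) (hlam : lam ≤ 1) (hη0 : 0 < η) (hη1 : η < 1) {r C : ℝ} (hr : 1 ≤ r)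
    (hηr : η * (1 - lamA) * r < 1) (hC : 0 ≤ C) (hgrow : ∀ τ, g τ ≤ C * r ^ τ)
    (hbdd : lamA = 0 → ∃ G, ∀ τ, g τ ≤ G) :
    ∃ ε : ℕ → ℝ, Tendsto ε atTop (𝓝 0) ∧
      ∀ N : ℕ, 1 ≤ N →
        ∀ Qf : Fin N → Bool → Bool → ℝ, IsNashQ g lam lamA cs ca η Qf →
          ∀ σc σa : ℕ → unitInterval, IsTruncatedPair Qf σc σa →
            (cost g lam lamA cs ca η (stationary σc) (stationary σa) ≠ ⊤ ∧
              cost g lam lamA cs ca η (stationary σc) (stationary σa) ≠ ⊥) ∧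
            (∀ πc : Policy,
              cost g lam lamA cs ca η (stationary σc) (stationary σa) ≤
                cost g lam lamA cs ca η πc (stationary σa) + (ε N : EReal)) ∧
            (∀ πa : Policy,
              cost g lam lamA cs ca η (stationary σc) (stationary σa) ≥
                cost g lam lamA cs ca η (stationary σc) πa - (ε N : EReal)) := by
  classical
  obtain ⟨e, he0, he⟩ := exists_truncErrorLE (cs := cs) (ca := ca) hg hmono hlamA hlt hlam hη0 hη1
    hr hηr hC hgrow hbdd
  choose b hb using fun T => exists_cost_le_of_transmit (cs := cs) (ca := ca) hmono hlamA hlt hlam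
    hη0 hη1 hr hηr hC hgrow T
  have hlow := fun πc πa => neg_le_cost (cs := cs) (ca := ca) hg hlamA hlt.le hlam hη0.le hη1 πc πa
  set c := (|cs| + |ca|) / (1 - η) with hc
  -- For levels where the good bound fails, the error is the spread between an upper bound valid for
  -- every controller transmitting from `N - 1` on and the universal lower bound `-c`; neither
  -- depends on the chosen pair.
  refine ⟨fun N => if TruncErrorLE g lam lamA cs ca η N (e N) then 2 * e N else b (N - 1) + c,
    ?_, fun N hN Qf hQ σc σa hσ => ⟨?_, ?_⟩⟩
  · have h2 : Tendsto (fun N => 2 * e N) atTop (𝓝 0) := by simpa using he0.const_mul 2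
    refine h2.congr' ?_
    filter_upwards [he] with N h
    rw [if_pos h]
  · have h1 := hb (N - 1) σc (fun τ hτ => (hσ.2 τ (by omega)).1) (stationary σa)
    exact ⟨(h1.trans_lt (EReal.coe_lt_top _)).ne,
      ((EReal.bot_lt_coe _).trans_le (hlow _ _)).ne'⟩
  · obtain ⟨v, d, hvd, hup, hlo⟩ : ∃ v d : ℝ,
        (if TruncErrorLE g lam lamA cs ca η N (e N) then 2 * e N else b (N - 1) + c) = d ∧
        (∀ πa, cost g lam lamA cs ca η (stationary σc) πa ≤ ((v + d : ℝ) : EReal)) ∧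
        ∀ πc, (v : EReal) ≤ cost g lam lamA cs ca η πc (stationary σa) := by
      by_cases h : TruncErrorLE g lam lamA cs ca η N (e N)
      · obtain ⟨h1, h2⟩ := h hN Qf hQ σc σa hσ
        refine ⟨truncValue hN Qf 0 - e N, 2 * e N, if_pos h, fun πa => ?_, h2⟩
        rw [show truncValue hN Qf 0 - e N + 2 * e N = truncValue hN Qf 0 + e N by ring]
        exact h1 πa
      · refine ⟨-c, b (N - 1) + c, if_neg h, fun πa => ?_, fun πc => hlow _ _⟩
        rw [show -c + (b (N - 1) + c) = b (N - 1) by ring]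
        exact hb (N - 1) σc (fun τ hτ => (hσ.2 τ (by omega)).1) πa
    simp only [hvd]
    refine ⟨fun πc => ?_, fun πa => ?_⟩
    · refine (hup _).trans ?_
      rw [EReal.coe_add]
      exact add_le_add_left (hlo πc) _
    · refine le_trans ?_ (hlo _)
      refine EReal.sub_le_of_le_add ?_
      rw [← EReal.coe_add]
      exact hup πa

end Errors

/-! ### Monotonicity and growth of the estimation cost -/

section Plant

variable {n m : ℕ}

open scoped MatrixOrder in
lemma trace_mul_nonneg {X Y : Matrix (Fin n) (Fin n) ℝ} (hX : X.PosSemidef) (hY : Y.PosSemidef) :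
    0 ≤ (X * Y).trace := by
  obtain ⟨Z, rfl⟩ := CStarAlgebra.nonneg_iff_eq_star_mul_self.1 hX.nonneg
  rw [Matrix.mul_assoc, Matrix.trace_mul_comm]
  exact (hY.mul_mul_conjTranspose_same Z).trace_nonneg

lemma posSemidef_conj_inv {F : Matrix (Fin n) (Fin n) ℝ} (hF : F.PosSemidef)
    (C : Matrix (Fin m) (Fin n) ℝ) {R : Matrix (Fin m) (Fin m) ℝ} (hR : R.PosDef) :
    (F * Cᵀ * (C * F * Cᵀ + R)⁻¹ * C * F).PosSemidef := by
  have h1 : (C * F * Cᵀ + R).PosSemidef := by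
    have := hF.mul_mul_conjTranspose_same C
    rw [Matrix.conjTranspose_eq_transpose_of_trivial] at this
    exact this.add hR.posSemidef
  have h2 := h1.inv.conjTranspose_mul_mul_same (C * F)
  have hFt : Fᵀ = F := by
    rw [← Matrix.conjTranspose_eq_transpose_of_trivial]
    exact hF.isHermitian
  rw [Matrix.conjTranspose_eq_transpose_of_trivial, Matrix.transpose_mul, hFt] at h2
  simpa only [Matrix.mul_assoc] using h2

lemma covStep_posSemidef {A Q X : Matrix (Fin n) (Fin n) ℝ} (hQ : Q.PosDef)
    (hX : X.PosSemidef) : (covStep A Q X).PosSemidef := by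
  have := hX.mul_mul_conjTranspose_same A
  rw [Matrix.conjTranspose_eq_transpose_of_trivial] at this
  exact this.add hQ.posSemidef

lemma covStep_iterate_posSemidef {A Q X : Matrix (Fin n) (Fin n) ℝ} (hQ : Q.PosDef)
    (hX : X.PosSemidef) (τ : ℕ) : ((covStep A Q)^[τ] X).PosSemidef := by
  induction τ with
  | zero => exact hX
  | succ τ ih =>
    rw [Function.iterate_succ_apply']
    exact covStep_posSemidef hQ ih

/-- The difference is the filter correction `K C f(P)`, a congruence of an inverse innovation
covariance. It starts the induction showing that the iterates of `f` increase. -/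
lemma IsSteadyStateCov.covStep_sub_posSemidef {A : Matrix (Fin n) (Fin n) ℝ}
    {C : Matrix (Fin m) (Fin n) ℝ} {Q : Matrix (Fin n) (Fin n) ℝ}
    {R : Matrix (Fin m) (Fin m) ℝ} {P : Matrix (Fin n) (Fin n) ℝ}
    (hP : IsSteadyStateCov A C Q R P) (hQ : Q.PosDef) (hR : R.PosDef) :
    (covStep A Q P - P).PosSemidef := by
  have e : covStep A Q P - P = covStep A Q P * Cᵀ * (C * covStep A Q P * Cᵀ + R)⁻¹ * C
      * covStep A Q P := by
    refine (congrArg (covStep A Q P - ·) hP.2).trans ?_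
    simp only [Matrix.sub_mul, Matrix.one_mul, sub_sub_cancel, kalmanGain]
  rw [e]
  exact posSemidef_conj_inv (covStep_posSemidef hQ hP.1) C hR

lemma covStep_iterate_succ_sub_posSemidef {A Q P : Matrix (Fin n) (Fin n) ℝ}
    (hP : (covStep A Q P - P).PosSemidef) (τ : ℕ) :
    ((covStep A Q)^[τ + 1] P - (covStep A Q)^[τ] P).PosSemidef := by
  induction τ with
  | zero => exact hP
  | succ τ ih =>
    rw [Function.iterate_succ_apply' _ (τ + 1), Function.iterate_succ_apply' _ τ]
    have e : ∀ X Y : Matrix (Fin n) (Fin n) ℝ, covStep A Q X - covStep A Q Y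
        = A * (X - Y) * Aᵀ := fun X Y => by
      simp only [covStep, Matrix.mul_sub, Matrix.sub_mul]
      abel
    rw [e]
    have := ih.mul_mul_conjTranspose_same A
    rwa [Matrix.conjTranspose_eq_transpose_of_trivial, Function.iterate_succ_apply'] at this

lemma IsRiccatiSolution.posSemidef_sub {A : Matrix (Fin n) (Fin n) ℝ}
    {B : Matrix (Fin n) (Fin m) ℝ} {W S : Matrix (Fin n) (Fin n) ℝ}
    {U : Matrix (Fin m) (Fin m) ℝ} {η : ℝ} (hS : IsRiccatiSolution A B W U η S)
    (hU : U.PosDef) (hη : 0 ≤ η) : (η • (Aᵀ * S * A) + W - S).PosSemidef := by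
  have hSt : Sᵀ = S := by
    rw [← Matrix.conjTranspose_eq_transpose_of_trivial]
    exact hS.1.isHermitian
  have h1 : (η • (Bᵀ * S * B) + U).PosSemidef := by
    have := hS.1.conjTranspose_mul_mul_same B
    rw [Matrix.conjTranspose_eq_transpose_of_trivial] at this
    exact (this.smul hη).add hU.posSemidef
  have h2 := (h1.inv.conjTranspose_mul_mul_same (Bᵀ * S * A)).smul (sq_nonneg η)
  have e : η • (Aᵀ * S * A) + W - S
      = η ^ 2 • ((Bᵀ * S * A)ᴴ * (η • (Bᵀ * S * B) + U)⁻¹ * (Bᵀ * S * A)) := by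
    refine (congrArg (η • (Aᵀ * S * A) + W - ·) hS.2).trans ?_
    rw [sub_sub_cancel, Matrix.conjTranspose_eq_transpose_of_trivial]
    simp only [Matrix.transpose_mul, Matrix.transpose_transpose, hSt, Matrix.mul_assoc]
  rw [e]
  exact h2

/-! ### Growth of the iterated covariance -/

lemma covStep_iterate_eq (A Q P : Matrix (Fin n) (Fin n) ℝ) (τ : ℕ) :
    (covStep A Q)^[τ] P
      = A ^ τ * P * (A ^ τ)ᵀ + ∑ i ∈ Finset.range τ, A ^ i * Q * (A ^ i)ᵀ := by
  induction τ with
  | zero => simp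
  | succ τ ih =>
    rw [Function.iterate_succ_apply', ih, covStep, Finset.sum_range_succ']
    simp only [pow_succ', Matrix.transpose_mul, Matrix.mul_add, Matrix.add_mul, Finset.mul_sum,
      Finset.sum_mul, Matrix.mul_assoc, pow_zero, Matrix.transpose_one, Matrix.one_mul,
      Matrix.mul_one, add_assoc]

/-- Powers of an element of a complex Banach algebra grow at most geometrically, at any rate
which exceeds the absolute values of its spectrum. -/
lemma exists_norm_pow_le {𝔸 : Type*} [NormedRing 𝔸] [NormedAlgebra ℂ 𝔸] [CompleteSpace 𝔸]
    (a : 𝔸) {s : ℝ} (hs : 0 < s) (h : ∀ z ∈ spectrum ℂ a, ‖z‖ < s) :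
    ∃ c : ℝ, 0 ≤ c ∧ ∀ k, ‖a ^ k‖ ≤ c * s ^ k := by
  rcases subsingleton_or_nontrivial 𝔸 with _ | _
  · refine ⟨0, le_rfl, fun k => ?_⟩
    rw [Subsingleton.elim (a ^ k) 0]
    simp
  · lift s to NNReal using hs.le
    -- Gelfand's formula gives the bound with constant `1` for large `k`; the finitely many
    -- remaining powers are absorbed by the sum in the constant.
    have hr : spectralRadius ℂ a < s := spectrum.spectralRadius_lt_of_forall_lt a h
    have hev := (spectrum.pow_nnnorm_pow_one_div_tendsto_nhds_spectralRadius a).eventually_lt_const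
      hr
    obtain ⟨K, hK⟩ := eventually_atTop.1 hev
    have hbig : ∀ k, K + 1 ≤ k → ‖a ^ k‖ ≤ (s : ℝ) ^ k := fun k hk => by
      have h1 := (hK k (by omega)).le
      have hk0 : (0 : ℝ) < k := by exact_mod_cast (by omega : 0 < k)
      have h2 := ENNReal.rpow_le_rpow h1 hk0.le
      rw [← ENNReal.rpow_mul, one_div, inv_mul_cancel₀ hk0.ne', ENNReal.rpow_one,
        ENNReal.rpow_natCast] at h2
      exact_mod_cast h2
    have hsum : ∀ k, 0 ≤ ‖a ^ k‖ / (s : ℝ) ^ k := fun k => by positivity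
    refine ⟨1 + ∑ k ∈ Finset.range (K + 1), ‖a ^ k‖ / (s : ℝ) ^ k,
      add_nonneg zero_le_one (Finset.sum_nonneg fun k _ => hsum k), fun k => ?_⟩
    have hpos : (0 : ℝ) < (s : ℝ) ^ k := pow_pos hs k
    rw [← div_le_iff₀ hpos]
    rcases lt_or_ge k (K + 1) with hk | hk
    · have := Finset.single_le_sum (f := fun k => ‖a ^ k‖ / (s : ℝ) ^ k) (fun k _ => hsum k)
        (Finset.mem_range.2 hk)
      linarith
    · have h1 : ‖a ^ k‖ / (s : ℝ) ^ k ≤ 1 := (div_le_one hpos).2 (hbig k hk)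
      have := Finset.sum_nonneg (s := Finset.range (K + 1)) fun k _ => hsum k
      linarith

lemma exists_le_mul_norm {E : Type*} [NormedAddCommGroup E] [NormedSpace ℝ E]
    [FiniteDimensional ℝ E] (L : E →ₗ[ℝ] ℝ) : ∃ c : ℝ, 0 ≤ c ∧ ∀ x, L x ≤ c * ‖x‖ :=
  ⟨_, norm_nonneg _, fun x => (le_abs_self _).trans ((LinearMap.toContinuousLinearMap L).le_opNorm x)⟩

open scoped Matrix.Norms.Frobenius

lemma exists_norm_matrix_pow_le (A : Matrix (Fin n) (Fin n) ℝ) {s : ℝ} (hs : 0 < s)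
    (h : ∀ z ∈ spectrum ℂ (A.map (algebraMap ℝ ℂ)), ‖z‖ < s) :
    ∃ c : ℝ, 0 ≤ c ∧ ∀ k, ‖A ^ k‖ ≤ c * s ^ k := by
  have : CompleteSpace (Matrix (Fin n) (Fin n) ℂ) := FiniteDimensional.complete ℂ _
  obtain ⟨c, hc, hb⟩ := exists_norm_pow_le (A.map (algebraMap ℝ ℂ)) hs h
  refine ⟨c, hc, fun k => ?_⟩
  have e : ‖A ^ k‖ = ‖(A.map (algebraMap ℝ ℂ)) ^ k‖ := by
    rw [← Matrix.map_pow]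
    exact (Matrix.frobenius_norm_map_eq _ _ fun x => by simp).symm
  rw [e]
  exact hb k

/-- Eigenvalues of modulus below `√x` give `‖A ^ k‖ ≤ c * √x ^ k`, so every term `A ^ i * X * (A ^
i)ᵀ` of the iterate is of order `x ^ i`. -/
lemma exists_trace_mul_covStep_iterate_le_geom_sum (A Q M P : Matrix (Fin n) (Fin n) ℝ) {x : ℝ}
    (hx : 0 < x) (h : ∀ z ∈ spectrum ℂ (A.map (algebraMap ℝ ℂ)), ‖z‖ ^ 2 < x) :
    ∃ c : ℝ, 0 ≤ c ∧ ∀ τ, (M * (covStep A Q)^[τ] P).trace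
      ≤ c * (x ^ τ + ∑ i ∈ Finset.range τ, x ^ i) := by
  obtain ⟨c, hc, hb⟩ := exists_norm_matrix_pow_le A (Real.sqrt_pos.2 hx)
    (fun z hz => Real.lt_sqrt_of_sq_lt (h z hz))
  obtain ⟨l, hl, hLM⟩ := exists_le_mul_norm
    ((Matrix.traceLinearMap (Fin n) ℝ ℝ).comp (LinearMap.mulLeft ℝ M))
  have hpow : ∀ (X : Matrix (Fin n) (Fin n) ℝ) i, ‖A ^ i * X * (A ^ i)ᵀ‖ ≤ c ^ 2 * ‖X‖ * x ^ i := by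
    intro X i
    calc ‖A ^ i * X * (A ^ i)ᵀ‖ ≤ ‖A ^ i‖ * ‖X‖ * ‖(A ^ i)ᵀ‖ :=
          (norm_mul_le _ _).trans (mul_le_mul_of_nonneg_right (norm_mul_le _ _) (norm_nonneg _))
      _ = ‖A ^ i‖ ^ 2 * ‖X‖ := by rw [Matrix.frobenius_norm_transpose]; ring
      _ ≤ (c * √x ^ i) ^ 2 * ‖X‖ := by gcongr; exact hb i
      _ = c ^ 2 * ‖X‖ * x ^ i := by
          rw [mul_pow, ← pow_mul, mul_comm i, pow_mul, Real.sq_sqrt hx.le]; ring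
  refine ⟨l * (c ^ 2 * (‖P‖ + ‖Q‖)), by positivity, fun τ => (hLM _).trans ?_⟩
  rw [mul_assoc]
  refine mul_le_mul_of_nonneg_left ?_ (hl)
  rw [covStep_iterate_eq]
  have h1 : ‖∑ i ∈ Finset.range τ, A ^ i * Q * (A ^ i)ᵀ‖
      ≤ c ^ 2 * ‖Q‖ * ∑ i ∈ Finset.range τ, x ^ i := by
    rw [Finset.mul_sum]
    exact norm_sum_le_of_le _ fun i _ => hpow Q i
  have h2 : 0 ≤ c ^ 2 * ‖Q‖ * x ^ τ := by positivity
  have h3 : 0 ≤ c ^ 2 * ‖P‖ * ∑ i ∈ Finset.range τ, x ^ i :=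
    mul_nonneg (by positivity) (Finset.sum_nonneg fun i _ => by positivity)
  refine (norm_add_le _ _).trans ?_
  have := hpow P τ
  linarith

/-- The estimation cost grows at most at a rate which the attacked channel can compensate. -/
lemma exists_trace_mul_covStep_iterate_le (A Q M P : Matrix (Fin n) (Fin n) ℝ) {η lamA : ℝ}
    (hη0 : 0 < η) (hη1 : η < 1) (hlamA0 : 0 ≤ lamA) (hlamA1 : lamA < 1)
    (hcond : ∀ z ∈ spectrum ℂ (A.map (algebraMap ℝ ℂ)), (1 - lamA) * ‖z‖ ^ 2 < η) :
    ∃ r c : ℝ, 1 ≤ r ∧ η * (1 - lamA) * r < 1 ∧ 0 ≤ c ∧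
      (∀ τ, (M * (covStep A Q)^[τ] P).trace ≤ c * r ^ τ) ∧ (lamA = 0 → r = 1) := by
  -- If `lamA = 0`, the spectrum satisfies `‖z‖ ^ 2 < η < 1`: the geometric sum converges and `r =
  -- 1` works. Otherwise `r = 1 / (1 - lamA)` exceeds every `‖z‖ ^ 2` and makes `η * (1 - lamA) * r`
  -- equal to `η`.
  rcases hlamA0.eq_or_lt with rfl | hpos
  · obtain ⟨c, hc, hb⟩ := exists_trace_mul_covStep_iterate_le_geom_sum A Q M P hη0
      (fun z hz => by simpa using hcond z hz)
    refine ⟨1, c * (1 + 1 / (1 - η)), le_rfl, by simpa using hη1, ?_, fun τ => ?_, fun _ => rfl⟩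
    · have : 0 < 1 - η := by linarith
      positivity
    · rw [one_pow, mul_one]
      refine (hb τ).trans (mul_le_mul_of_nonneg_left (add_le_add (pow_le_one₀ hη0.le hη1.le) ?_) hc)
      have : 0 < 1 - η := by linarith
      rw [le_div_iff₀ this, geom_sum_mul_neg]
      exact sub_le_self _ (pow_nonneg hη0.le τ)
  · have hl : 0 < 1 - lamA := by linarith
    set r := (1 - lamA)⁻¹ with hr
    have hr1 : 1 < r := (one_lt_inv₀ hl).2 (by linarith)
    have hlr : (1 - lamA) * r = 1 := mul_inv_cancel₀ hl.ne'
    obtain ⟨c, hc, hb⟩ := exists_trace_mul_covStep_iterate_le_geom_sum A Q M P (zero_lt_one.trans hr1)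
      (fun z hz => by
        refine lt_of_mul_lt_mul_left ?_ hl.le
        rw [hlr]
        exact (hcond z hz).trans hη1)
    have hr1' : 0 < r - 1 := by linarith
    refine ⟨r, c * (1 + 1 / (r - 1)), hr1.le, by rwa [mul_assoc, hlr, mul_one], by positivity,
      fun τ => ?_, fun h => absurd h hpos.ne'⟩
    rw [mul_assoc]
    refine (hb τ).trans (mul_le_mul_of_nonneg_left ?_ hc)
    rw [add_mul, one_mul]
    refine add_le_add_right ?_ _
    rw [geom_sum_eq hr1.ne', div_mul_eq_mul_div, one_mul]
    exact div_le_div_of_nonneg_right (by linarith) hr1'.le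

end Plant

end HoldingGame

end

/-! ### The theorem for the plant -/

theorem theorem2 {nx nu ny : ℕ}
    (A : Matrix (Fin nx) (Fin nx) ℝ) (B : Matrix (Fin nx) (Fin nu) ℝ)
    (C : Matrix (Fin ny) (Fin nx) ℝ)
    (Q : Matrix (Fin nx) (Fin nx) ℝ) (R : Matrix (Fin ny) (Fin ny) ℝ)
    (W : Matrix (Fin nx) (Fin nx) ℝ) (U : Matrix (Fin nu) (Fin nu) ℝ)
    (P S : Matrix (Fin nx) (Fin nx) ℝ) (η lam lamA cs ca : ℝ)
    (hQ : Q.PosDef) (hR : R.PosDef) (hW : W.PosSemidef) (hU : U.PosDef)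
    (hη0 : 0 < η) (hη1 : η < 1)
    (hlamA : 0 ≤ lamA) (hlt : lamA < lam) (hlam : lam ≤ 1)
    (hP : HoldingGame.IsSteadyStateCov A C Q R P)
    (hS : HoldingGame.IsRiccatiSolution A B W U η S)
    (hcond : ∀ μ ∈ spectrum ℂ (A.map (algebraMap ℝ ℂ)), (1 - lamA) * ‖μ‖ ^ 2 < η) :
    let g : ℕ → ℝ := HoldingGame.estCost A Q W η S P
    let J : HoldingGame.Policy → HoldingGame.Policy → EReal :=
      HoldingGame.cost g lam lamA cs ca η
    (∀ N : ℕ, 1 ≤ N →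
      ∃! Qf : Fin N → Bool → Bool → ℝ, HoldingGame.IsNashQ g lam lamA cs ca η Qf) ∧
    (∀ (N : ℕ) (Qf : Fin N → Bool → Bool → ℝ),
      ∃ σc σa : ℕ → unitInterval, HoldingGame.IsTruncatedPair Qf σc σa) ∧
    ∃ ε : ℕ → ℝ, Tendsto ε atTop (𝓝 0) ∧
      ∀ N : ℕ, 1 ≤ N →
        ∀ Qf : Fin N → Bool → Bool → ℝ, HoldingGame.IsNashQ g lam lamA cs ca η Qf →
          ∀ σc σa : ℕ → unitInterval, HoldingGame.IsTruncatedPair Qf σc σa →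
            (J (HoldingGame.stationary σc) (HoldingGame.stationary σa) ≠ ⊤ ∧
              J (HoldingGame.stationary σc) (HoldingGame.stationary σa) ≠ ⊥) ∧
            (∀ πc : HoldingGame.Policy,
              J (HoldingGame.stationary σc) (HoldingGame.stationary σa) ≤
                J πc (HoldingGame.stationary σa) + (ε N : EReal)) ∧
            (∀ πa : HoldingGame.Policy,
              J (HoldingGame.stationary σc) (HoldingGame.stationary σa) ≥
                J (HoldingGame.stationary σc) πa - (ε N : EReal)) := by
  have hMpos := hS.posSemidef_sub hU hη0.le
  have hdiff := hP.covStep_sub_posSemidef hQ hR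
  have hlamA1 := hlt.trans_le hlam
  have hg : ∀ τ, 0 ≤ HoldingGame.estCost A Q W η S P τ := fun τ =>
    HoldingGame.trace_mul_nonneg hMpos (HoldingGame.covStep_iterate_posSemidef hQ hP.1 τ)
  have hmono : Monotone (HoldingGame.estCost A Q W η S P) := monotone_nat_of_le_succ fun τ => by
    have := HoldingGame.trace_mul_nonneg hMpos (HoldingGame.covStep_iterate_succ_sub_posSemidef hdiff τ)
    rw [Matrix.mul_sub, Matrix.trace_sub] at this
    exact sub_nonneg.1 this
  obtain ⟨r, c, hr, hηr, hc, hgrow, hr0⟩ := HoldingGame.exists_trace_mul_covStep_iterate_le A Q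
    (η • (Aᵀ * S * A) + W - S) P hη0 hη1 hlamA hlamA1 hcond
  exact ⟨fun N _ => HoldingGame.existsUnique_isNashQ hlamA hlt.le hlam hη0.le hη1 N,
    fun _ Qf => HoldingGame.exists_isTruncatedPair Qf,
    HoldingGame.exists_tendsto_isApproxNash hg hmono hlamA hlt hlam hη0 hη1 hr hηr hc hgrow
      fun h => ⟨c, fun τ => by simpa [HoldingGame.estCost, hr0 h] using hgrow τ⟩⟩
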